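/- Let $d\ge 2$ and let $f:\mathbb R^d\to\mathbb R$ be twice differentiable with, for some $\mu,L,M>0$, $$\mu I\preceq\nabla^2 f(x)\preceq L I\quad\forall x,\qquad \nabla^2 f(y)-\nabla^2 f(x)\preceq M\|y-x\|_z\,\nabla^2 f(w)\quad\forall x,y,z,w,$$ where $\|v\|_A=\sqrt{v^\top A v}$ and $\|v\|_z=\|v\|_{\nabla^2 f(z)}$ ($f$ is $\mu$-strongly convex, $L$-smooth and $M$-strongly self-concordant). Put $\varkappa=L/\mu$ and $\lambda_f(x)=\sqrt{\nabla f(x)^\top[\nabla^2 f(x)]^{-1}\nabla f(x)}$. Consider the following methods, started from $x_0$ and $G_0=L I$ (and $L_0=I/\sqrt L$ for BFGS). At step $k\ge0$ set $x_{k+1}=x_k-G_k^{-1}\nabla f(x_k)$, $r_k=\|x_{k+1}-x_k\|_{x_k}$, $\tilde G_k=(1+Mr_k)G_k$, $\tilde L_k=L_k/\sqrt{1+Mr_k}$, $A_k=\nabla^2 f(x_{k+1})$. - SR1: choose $u_k$, and let $G_{k+1}=\tilde G_k-\dfrac{(\tilde G_k-A_k)u_ku_k^\top(\tilde G_k-A_k)}{u_k^\top(\tilde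 G_k-A_k)u_k}$ if $\tilde G_ku_k\ne A_ku_k$, and $G_{k+1}=\tilde G_k$ otherwise. Greedy: $u_k$ is any maximizer of $u^\top(\tilde G_k-A_k)u$ over the standard basis $\{e_1,\dots,e_d\}$. Random: the $u_k$ are independent and uniform on the unit sphere. - BFGS: choose $\tilde u_k$, put $u_k=\tilde L_k^\top\tilde u_k$, and let $G_{k+1}=\tilde G_k-\dfrac{\tilde G_ku_ku_k^\top\tilde G_k}{u_k^\top\tilde G_ku_k}+\dfrac{A_ku_ku_k^\top A_k}{u_k^\top A_ku_k}$ and $L_{k+1}=\tilde L_k-\dfrac{(\tilde L_kA_ku_k-v_k)u_k^\top}{u_k^\top A_ku_k}$ with $v_k=\dfrac{\|u_k\|_{A_k}}{\|\tilde u_k\|}\tilde u_k$. Greedy: $\tilde u_k$ is any maximizer of $\tilde u^\top\tilde L_k^{-\top}A_k^{-1}\tilde L_k^{-1}\tilde u$ over $\{e_1,\dots,e_d\}$. Random: the $\tilde u_k$ are independent and uniform on the unit sphere. Write $\lambda_k=\lambda_f(x_k)$ and suppose that $M\lambda_0\le\dfrac{\ln(3/2)}{4\varkappa}$. Then there is an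 absolute constant $C>0$ such that the following hold. 1) There is a $k_0\in\mathbb N$, depending only on $d$ and $\varkappa$, with $k_0\le C(d+\varkappa)\ln(d\varkappa)$, such that for greedy BFGS and for greedy SR1 $$\lambda_{k_0+k}\le\Big(1-\frac1d\Big)^{k(k-1)/2}\Big(\frac12\Big)^k\Big(1-\frac1{2\varkappa}\Big)^{k_0}\lambda_0\qquad\text{for all }k\ge0.$$ 2) For every $\delta\in(0,1)$ there is a $k_0\in\mathbb N$, depending only on $d$, $\varkappa$ and $\delta$, with $k_0\le C(d+\varkappa)\ln(d\varkappa/\delta)$, such that for random BFGS, and likewise for random SR1, with probability at least $1-\delta$ over the random directions, $$\lambda_{k_0+k}\le\Big(1-\frac1{d+1}\Big)^{k(k-1)/2}\Big(\frac12\Big)^k\Big(1-\frac1{2\varkappa}\Big)^{k_0}\lambda_0\qquad\text{for all }k\ge0.$$ -/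

import Mathlib

noncomputable section

namespace QuasiNewton

open scoped Matrix

variable {d : ℕ}

/-- The Euclidean space `ℝ^d`. -/
abbrev Vec (d : ℕ) : Type := EuclideanSpace ℝ (Fin d)

/-- Real `d × d` matrices. -/
abbrev Mat (d : ℕ) : Type := Matrix (Fin d) (Fin d) ℝ

/-- The standard basis vector `e_i`. -/
def stdVec (i : Fin d) : Vec d := EuclideanSpace.single i 1

/-- The product `A v` of a matrix and a vector. -/
def app (A : Mat d) (v : Vec d) : Vec d := WithLp.toLp 2 (A *ᵥ v.ofLp)

/-- The quadratic form `vᵀ A v`. -/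
def quad (A : Mat d) (v : Vec d) : ℝ := v.ofLp ⬝ᵥ (A *ᵥ v.ofLp)

/-- The outer product `u vᵀ`. -/
def outer (u v : Vec d) : Mat d := Matrix.vecMulVec u.ofLp v.ofLp

/-- The norm `‖v‖_A = √(vᵀ A v)`. -/
def normOf (A : Mat d) (v : Vec d) : ℝ := Real.sqrt (quad A v)

/-- The Loewner order `A ⪯ B`: the matrix `B - A` is positive semidefinite. -/
def LoewnerLE (A B : Mat d) : Prop := (B - A).PosSemidef

/-- The function `f` is twice (Fréchet) differentiable on `ℝ^d`. -/
def TwiceDifferentiable (f : Vec d → ℝ) : Prop :=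
  Differentiable ℝ f ∧ Differentiable ℝ (fderiv ℝ f)

/-- The Hessian matrix of `f` at `x`, with entries `∂_i ∂_j f (x)`. -/
def hess (f : Vec d → ℝ) (x : Vec d) : Mat d :=
  Matrix.of fun i j => fderiv ℝ (fderiv ℝ f) x (stdVec i) (stdVec j)

/-- `f` is `μ`-strongly convex and `L`-smooth: `μ I ⪯ ∇²f(x) ⪯ L I` for all `x`. -/
structure StronglyConvexSmooth (μ L : ℝ) (f : Vec d → ℝ) : Prop where
  mu_pos : 0 < μ
  L_pos : 0 < L
  twice_diff : TwiceDifferentiable f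
  lower : ∀ x, LoewnerLE (μ • (1 : Mat d)) (hess f x)
  upper : ∀ x, LoewnerLE (hess f x) (L • (1 : Mat d))

/-- `f` is `M`-strongly self-concordant:
`∇²f(y) - ∇²f(x) ⪯ M ‖y - x‖_z ∇²f(w)` for all `x, y, z, w`. -/
structure StronglySelfConcordant (M : ℝ) (f : Vec d → ℝ) : Prop where
  M_pos : 0 < M
  twice_diff : TwiceDifferentiable f
  hess_close : ∀ x y z w : Vec d,
    LoewnerLE (hess f y - hess f x) ((M * normOf (hess f z) (y - x)) • hess f w)

/-- `λ_f(x) = √(∇f(x)ᵀ [∇²f(x)]⁻¹ ∇f(x))`. -/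
def lam (f : Vec d → ℝ) (x : Vec d) : ℝ := normOf (hess f x)⁻¹ (gradient f x)

/-- The SR1 update of `G` towards `A` along `u`. -/
def sr1 (G A : Mat d) (u : Vec d) : Mat d :=
  open Classical in
  if app G u = app A u then G
  else G - (quad (G - A) u)⁻¹ • outer (app (G - A) u) (app (G - A) u)

/-- The BFGS update of the symmetric matrix `G` towards the symmetric matrix `A` along `u ≠ 0`. -/
def bfgs (G A : Mat d) (u : Vec d) : Mat d :=
  G - (quad G u)⁻¹ • outer (app G u) (app G u) + (quad A u)⁻¹ • outer (app A u) (app A u)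

/-- The update of the factor `F` (where `Fᵀ F = G⁻¹`) that goes with the BFGS update along
`u = Fᵀ w`: the new factor is `F - (F A u - v) uᵀ / (uᵀ A u)` with `v = (‖u‖_A / ‖w‖) w`. -/
def factorUpdate (F A : Mat d) (w : Vec d) : Mat d :=
  let u : Vec d := app Fᵀ w
  let v : Vec d := (normOf A u / ‖w‖) • w
  F - (quad A u)⁻¹ • outer (app F (app A u) - v) u

/-- The quasi-Newton step `x₊ = x - G⁻¹ ∇f(x)`. -/
def nextPoint (f : Vec d → ℝ) (x : Vec d) (G : Mat d) : Vec d :=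
  x - app G⁻¹ (gradient f x)

/-- The correction factor `1 + M r` with `r = ‖x₊ - x‖_x`. -/
def corr (f : Vec d → ℝ) (M : ℝ) (x : Vec d) (G : Mat d) : ℝ :=
  1 + M * normOf (hess f x) (nextPoint f x G - x)

/-- The data `(x_k, G_k)` of the SR1 method. -/
structure SR1State (d : ℕ) where
  x : Vec d
  G : Mat d

/-- The corrected matrix `(1 + M r_k) G_k`. -/
def SR1State.Gcorr (f : Vec d → ℝ) (M : ℝ) (s : SR1State d) : Mat d := corr f M s.x s.G • s.G

/-- The SR1 method with directions `u₀, u₁, …`, started from `x₀` and `G₀ = L I`. -/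
def sr1Iter (f : Vec d → ℝ) (M L : ℝ) (x₀ : Vec d) (u : ℕ → Vec d) : ℕ → SR1State d
  | 0 => ⟨x₀, L • (1 : Mat d)⟩
  | k + 1 =>
    let s := sr1Iter f M L x₀ u k
    let x' := nextPoint f s.x s.G
    ⟨x', sr1 (s.Gcorr f M) (hess f x') (u k)⟩

/-- The data `(x_k, G_k, L_k)` of the BFGS method; the factor `L_k` is called `F`. -/
structure BFGSState (d : ℕ) where
  x : Vec d
  G : Mat d
  F : Mat d

/-- The corrected matrix `(1 + M r_k) G_k`. -/
def BFGSState.Gcorr (f : Vec d → ℝ) (M : ℝ) (s : BFGSState d) : Mat d := corr f M s.x s.G • s.G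

/-- The corrected factor `L_k / √(1 + M r_k)`. -/
def BFGSState.Fcorr (f : Vec d → ℝ) (M : ℝ) (s : BFGSState d) : Mat d :=
  (Real.sqrt (corr f M s.x s.G))⁻¹ • s.F

/-- The BFGS method with unscaled directions `w₀, w₁, …`, started from `x₀`, `G₀ = L I` and
`L₀ = I / √L`; the update of the `k`-th corrected matrix is along the `k`-th corrected factor,
transposed, applied to `w_k`. -/
def bfgsIter (f : Vec d → ℝ) (M L : ℝ) (x₀ : Vec d) (w : ℕ → Vec d) : ℕ → BFGSState d
  | 0 => ⟨x₀, L • (1 : Mat d), (Real.sqrt L)⁻¹ • (1 : Mat d)⟩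
  | k + 1 =>
    let s := bfgsIter f M L x₀ w k
    let x' := nextPoint f s.x s.G
    ⟨x', bfgs (s.Gcorr f M) (hess f x') (app (s.Fcorr f M)ᵀ (w k)),
      factorUpdate (s.Fcorr f M) (hess f x') (w k)⟩

/-- `u` maximizes `q` over the standard basis `{e_1, …, e_d}`. -/
def IsArgmaxStdVec (q : Vec d → ℝ) (u : Vec d) : Prop :=
  ∃ i : Fin d, u = stdVec i ∧ ∀ j : Fin d, q (stdVec j) ≤ q (stdVec i)

/-- The directions `u` are the ones that greedy SR1 chooses: at each step `u_k` maximizes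
`uᵀ (G - A) u` over the standard basis, where `G` is the corrected matrix and `A = ∇²f(x_{k+1})`. -/
def IsGreedySR1 (f : Vec d → ℝ) (M L : ℝ) (x₀ : Vec d) (u : ℕ → Vec d) : Prop :=
  ∀ k, IsArgmaxStdVec
    (quad ((sr1Iter f M L x₀ u k).Gcorr f M - hess f (sr1Iter f M L x₀ u (k + 1)).x)) (u k)

/-- The directions `w` are the ones that greedy BFGS chooses: at each step `w_k` maximizes
`wᵀ F⁻ᵀ A⁻¹ F⁻¹ w` over the standard basis, where `F` is the corrected factor and
`A = ∇²f(x_{k+1})`. -/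
def IsGreedyBFGS (f : Vec d → ℝ) (M L : ℝ) (x₀ : Vec d) (w : ℕ → Vec d) : Prop :=
  ∀ k, IsArgmaxStdVec
    (quad ((((bfgsIter f M L x₀ w k).Fcorr f M)⁻¹)ᵀ *
      (hess f (bfgsIter f M L x₀ w (k + 1)).x)⁻¹ * ((bfgsIter f M L x₀ w k).Fcorr f M)⁻¹)) (w k)

/-- The unit sphere of `ℝ^d`. -/
abbrev USphere (d : ℕ) : Type := Metric.sphere (0 : Vec d) 1

/-- The uniform distribution on the unit sphere: normalized surface measure. -/
def unifSphere (d : ℕ) : MeasureTheory.Measure (USphere d) :=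
  ((MeasureTheory.volume : MeasureTheory.Measure (Vec d)).toSphere Set.univ)⁻¹ •
    (MeasureTheory.volume : MeasureTheory.Measure (Vec d)).toSphere

/-- `u₀, u₁, …` are independent random vectors, each uniformly distributed on the unit sphere. -/
structure IsIIDUnifSphere {Ω : Type*} [MeasurableSpace Ω] (P : MeasureTheory.Measure Ω)
    (u : ℕ → Ω → USphere d) : Prop where
  measurable : ∀ k, Measurable (u k)
  law : ∀ k, P.map (u k) = unifSphere d
  indep : ProbabilityTheory.iIndepFun u P

/-- The standing assumptions on the objective `f` and on the starting point `x₀`, with condition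
number `κ = L / μ`. -/
structure Setting (M μ L κ : ℝ) (f : Vec d → ℝ) (x₀ : Vec d) : Prop where
  self_conc : StronglySelfConcordant M f
  convex_smooth : StronglyConvexSmooth μ L f
  cond_eq : κ = L / μ
  init : M * lam f x₀ ≤ Real.log (3 / 2) / (4 * κ)

/-- The bound
`λ_{k₀+k} ≤ q^{k(k-1)/2} (1/2)^k (1 - 1/(2κ))^{k₀} λ₀` for all `k ≥ 0`
along a sequence of points `x`. The exponent is exact, since `k (k - 1)` is even. -/
def SuperlinearFrom (f : Vec d → ℝ) (q κ : ℝ) (k₀ : ℕ) (x : ℕ → Vec d) : Prop :=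
  ∀ k : ℕ, lam f (x (k₀ + k)) ≤
    q ^ (k * (k - 1) / 2) * (1 / 2 : ℝ) ^ k * (1 - 1 / (2 * κ)) ^ k₀ * lam f (x 0)

end QuasiNewton

end

/-!
Why the two quasi-Newton methods converge superlinearly after a burn-in.

Write `H = ∇²f(x)`, and suppose that `H ⪯ G ⪯ η H` (`Sandwich`). One quasi-Newton step then
satisfies `λ_f(x₊) ≤ (1 + a/2) (η - 1 + a) / η · λ_f(x)` with `a = M ‖x₊ - x‖_x ≤ M λ_f(x)`
(`lam_nextPoint_le`), the corrected matrix `(1 + a) G` lies between `∇²f(x₊)` and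
`(1 + a)² η ∇²f(x₊)`, and SR1 and BFGS updates keep such a sandwich (`Sandwich.sr1`,
`Sandwich.bfgs`). The initial matrix `L I` has `η = κ`; since `M λ₀` is small compared with `1 / κ`,
`η` never exceeds `3 κ / 2` and `λ` decays linearly with rate `1 - 1 / (2 κ)` (`LinearPhase`).

The update rules enter through a potential `σ = tr (W (G - H))`, where `W = H⁻¹` for BFGS and
`W = I / μ` for SR1 (`IsWeight`); it bounds `η - 1`. An update along a direction given by a unit
vector `w` lowers the corrected potential by at least `wᵀ Q w`, for a matrix `Q` whose trace is that
potential (`trace_sr1_sub_le`; `trace_bfgs`, which uses that the factor `F` satisfies `Fᵀ F = G⁻¹`).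
The greedy choice of `w` makes `wᵀ Q w` at least its average over the standard basis, and a uniform
`w` on the sphere makes it equal in expectation to that average, which is `tr Q / d`
(`integral_quad`). In both cases the corrected potential shrinks by the factor `1 - 1 / d`.

The movement of the point adds `O(d κ M λ)` to the potential, and `λ₊ ≤ (1 + a/2) (σ + M λ) λ`.
Hence `θ = σ + 3 d κ M λ` contracts by `(1 - 1 / d) (1 + O(d κ M λ))` (`LinearPhase.contraction`).
After the first `O(κ ln (d κ))` steps the product of the second factors is bounded by a constant,
and `O(d ln (d κ / δ))` further steps bring `θ` down to a small constant; from then on each step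
gains a factor `(1/2) (1 - 1 / d)^i` on `λ`. For random directions the contraction holds for the
expectation of `θ`, because the state is independent of the next direction
(`lintegral_comp_of_indepFun`); Markov's inequality at all times together, with the slightly worse
rate `1 - 1 / (d + 1)` leaving room for a convergent union bound, gives the claim with probability
`1 - δ` (`measure_superlinearFrom_ge`).
-/

noncomputable section

namespace QuasiNewton

open scoped Matrix

/-! ### Quadratic forms and the Loewner order -/

section

theorem isHermitian_vecMulVec_self {n : Type*} (v : n → ℝ) : (Matrix.vecMulVec v v).IsHermitian := by
  ext i j
  simp [Matrix.vecMulVec_apply, mul_comm]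

theorem isHermitian_real_smul {n : Type*} {A : Matrix n n ℝ} (hA : A.IsHermitian) (c : ℝ) :
    (c • A).IsHermitian := by
  rw [Matrix.IsHermitian, Matrix.conjTranspose_smul, hA]; simp

variable {n : Type*} [Fintype n]

theorem bilin_comm {A : Matrix n n ℝ} (hA : A.IsHermitian) (u v : n → ℝ) :
    u ⬝ᵥ A *ᵥ v = v ⬝ᵥ A *ᵥ u := by
  rw [Matrix.dotProduct_mulVec, ← Matrix.mulVec_transpose, dotProduct_comm]
  congr 2

theorem form_add_smul {A : Matrix n n ℝ} (hA : A.IsHermitian) (u v : n → ℝ) (t : ℝ) :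
    (u + t • v) ⬝ᵥ A *ᵥ (u + t • v) = u ⬝ᵥ A *ᵥ u + 2 * t * (u ⬝ᵥ A *ᵥ v) + t ^ 2 * (v ⬝ᵥ A *ᵥ v) := by
  simp only [Matrix.mulVec_add, Matrix.mulVec_smul, add_dotProduct, dotProduct_add, smul_dotProduct,
    dotProduct_smul, smul_eq_mul, bilin_comm hA v u]
  ring

theorem form_nonneg {A : Matrix n n ℝ} (hA : A.PosSemidef) (v : n → ℝ) : 0 ≤ v ⬝ᵥ A *ᵥ v := by
  simpa using hA.dotProduct_mulVec_nonneg v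

theorem form_pos {A : Matrix n n ℝ} (hA : A.PosDef) {v : n → ℝ} (hv : v ≠ 0) :
    0 < v ⬝ᵥ A *ᵥ v := by
  simpa using hA.dotProduct_mulVec_pos hv

theorem posSemidef_of_form_nonneg {A : Matrix n n ℝ} (hA : A.IsHermitian)
    (h : ∀ v, 0 ≤ v ⬝ᵥ A *ᵥ v) : A.PosSemidef :=
  Matrix.PosSemidef.of_dotProduct_mulVec_nonneg hA (by simpa using h)

theorem trace_mul_vecMulVec (W : Matrix n n ℝ) (u v : n → ℝ) :
    (W * Matrix.vecMulVec u v).trace = v ⬝ᵥ W *ᵥ u := by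
  rw [Matrix.mul_vecMulVec, Matrix.trace_vecMulVec, dotProduct_comm]

theorem form_vecMulVec (a b u v : n → ℝ) :
    u ⬝ᵥ Matrix.vecMulVec a b *ᵥ v = (u ⬝ᵥ a) * (b ⬝ᵥ v) := by
  rw [Matrix.vecMulVec_mulVec]
  simp [mul_comm]

theorem form_smul (A : Matrix n n ℝ) (c : ℝ) (u v : n → ℝ) :
    u ⬝ᵥ (c • A) *ᵥ v = c * (u ⬝ᵥ A *ᵥ v) := by
  rw [Matrix.smul_mulVec, dotProduct_smul, smul_eq_mul]

/-- A symmetric matrix whose form is bounded by `ρ` times the form of `K` satisfies the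
Cauchy–Schwarz inequality of `K` up to `ρ²`. -/
theorem sq_bilin_le {N K : Matrix n n ℝ} (hN : N.IsHermitian) (hK : K.IsHermitian) {ρ : ℝ}
    (h : ∀ v, |v ⬝ᵥ N *ᵥ v| ≤ ρ * (v ⬝ᵥ K *ᵥ v)) (u v : n → ℝ) :
    (u ⬝ᵥ N *ᵥ v) ^ 2 ≤ ρ ^ 2 * ((u ⬝ᵥ K *ᵥ u) * (v ⬝ᵥ K *ᵥ v)) := by
  -- Polarization bounds `2 t (uᵀ N v)` by `ρ (uᵀ K u + t² vᵀ K v)` for every real `t`.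
  have key : ∀ t : ℝ, 0 ≤ (ρ * (v ⬝ᵥ K *ᵥ v)) * (t * t) + (-2 * (u ⬝ᵥ N *ᵥ v)) * t
      + ρ * (u ⬝ᵥ K *ᵥ u) := by
    intro t
    have h1 := (abs_le.1 (h (u + t • v))).2
    have h2 := (abs_le.1 (h (u + (-t) • v))).1
    rw [form_add_smul hN, form_add_smul hK] at h1 h2
    nlinarith
  have := discrim_le_zero key
  rw [discrim] at this
  nlinarith

theorem cauchy_schwarz_form {K : Matrix n n ℝ} (hK : K.PosSemidef) (u v : n → ℝ) :
    (u ⬝ᵥ K *ᵥ v) ^ 2 ≤ (u ⬝ᵥ K *ᵥ u) * (v ⬝ᵥ K *ᵥ v) := by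
  have := sq_bilin_le hK.isHermitian hK.isHermitian (ρ := 1)
    (fun v => by rw [one_mul, abs_of_nonneg (form_nonneg hK v)]) u v
  simpa using this

variable [DecidableEq n]

theorem mul_inv_of_posDef {A : Matrix n n ℝ} (hA : A.PosDef) : A * A⁻¹ = 1 :=
  Matrix.mul_nonsing_inv _ ((Matrix.isUnit_iff_isUnit_det _).1 hA.isUnit)

theorem inv_mul_of_posDef {A : Matrix n n ℝ} (hA : A.PosDef) : A⁻¹ * A = 1 :=
  Matrix.nonsing_inv_mul _ ((Matrix.isUnit_iff_isUnit_det _).1 hA.isUnit)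

theorem mulVec_inv_mulVec {A : Matrix n n ℝ} (hA : A.PosDef) (v : n → ℝ) : A *ᵥ (A⁻¹ *ᵥ v) = v := by
  rw [Matrix.mulVec_mulVec, mul_inv_of_posDef hA, Matrix.one_mulVec]

theorem inv_mulVec_mulVec {A : Matrix n n ℝ} (hA : A.PosDef) (v : n → ℝ) : A⁻¹ *ᵥ (A *ᵥ v) = v := by
  rw [Matrix.mulVec_mulVec, inv_mul_of_posDef hA, Matrix.one_mulVec]

/-- Inversion reverses the Loewner order. The scalar `c` saves rescaling at the points of use. -/
theorem form_inv_le {A B : Matrix n n ℝ} (hA : A.PosDef) (hB : B.PosDef) {c : ℝ} (hc : 0 < c)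
    (h : ∀ v, v ⬝ᵥ A *ᵥ v ≤ c * (v ⬝ᵥ B *ᵥ v)) (x : n → ℝ) :
    x ⬝ᵥ B⁻¹ *ᵥ x ≤ c * (x ⬝ᵥ A⁻¹ *ᵥ x) := by
  -- Expand `0 ≤ (A⁻¹ x - t y)ᵀ A (A⁻¹ x - t y)` at `y = B⁻¹ x`, `t = 1 / c`.
  have h1 := form_nonneg hA.posSemidef (A⁻¹ *ᵥ x + (-c⁻¹) • (B⁻¹ *ᵥ x))
  rw [form_add_smul hA.isHermitian, bilin_comm hA.isHermitian (A⁻¹ *ᵥ x) (B⁻¹ *ᵥ x),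
    mulVec_inv_mulVec hA] at h1
  have h2 := h (B⁻¹ *ᵥ x)
  rw [mulVec_inv_mulVec hB] at h2
  rw [dotProduct_comm (A⁻¹ *ᵥ x), dotProduct_comm (B⁻¹ *ᵥ x)] at h1
  rw [dotProduct_comm (B⁻¹ *ᵥ x) x] at h2
  have h3 : c⁻¹ ^ 2 * (B⁻¹ *ᵥ x ⬝ᵥ A *ᵥ B⁻¹ *ᵥ x) ≤ c⁻¹ * (x ⬝ᵥ B⁻¹ *ᵥ x) := by
    calc _ ≤ c⁻¹ ^ 2 * (c * (x ⬝ᵥ B⁻¹ *ᵥ x)) := by gcongr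
      _ = _ := by field_simp
  have h4 : c⁻¹ * (x ⬝ᵥ B⁻¹ *ᵥ x) ≤ x ⬝ᵥ A⁻¹ *ᵥ x := by nlinarith
  calc _ = c * (c⁻¹ * (x ⬝ᵥ B⁻¹ *ᵥ x)) := by field_simp
    _ ≤ _ := by gcongr

open scoped MatrixOrder in
theorem trace_mul_nonneg {W R : Matrix n n ℝ} (hW : W.PosSemidef) (hR : R.PosSemidef) :
    0 ≤ (W * R).trace := by
  obtain ⟨S, hS, -, rfl⟩ :=
    CFC.exists_sqrt_of_isSelfAdjoint_of_quasispectrumRestricts hR.isHermitian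
      (QuasispectrumRestricts.nnreal_of_nonneg hR.nonneg)
  rw [← mul_assoc, Matrix.trace_mul_comm, ← mul_assoc]
  have h := (hW.mul_mul_conjTranspose_same S).trace_nonneg
  rwa [← Matrix.star_eq_conjTranspose, hS.star_eq] at h

/-- The largest eigenvalue of `A⁻¹ R` is at most its trace. -/
theorem form_le_trace_mul_form {A R : Matrix n n ℝ} (hA : A.PosDef) (hR : R.PosSemidef)
    (v : n → ℝ) : v ⬝ᵥ R *ᵥ v ≤ (A⁻¹ * R).trace * (v ⬝ᵥ A *ᵥ v) := by
  rcases eq_or_ne v 0 with rfl | hv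
  · simp
  have hpos := form_pos hA hv
  -- By Cauchy–Schwarz `A⁻¹ - v vᵀ / (vᵀ A v)` is positive semidefinite.
  have hW : (A⁻¹ - (v ⬝ᵥ A *ᵥ v)⁻¹ • Matrix.vecMulVec v v).PosSemidef := by
    apply posSemidef_of_form_nonneg
    · refine hA.inv.isHermitian.sub ?_
      ext i j
      simp [Matrix.vecMulVec_apply, mul_comm]
    · intro x
      have := cauchy_schwarz_form hA.posSemidef (A⁻¹ *ᵥ x) v
      rw [bilin_comm hA.isHermitian _ v, mulVec_inv_mulVec hA, dotProduct_comm _ x] at this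
      rw [Matrix.sub_mulVec, dotProduct_sub, form_smul, form_vecMulVec, dotProduct_comm x v,
        sub_nonneg, inv_mul_le_iff₀ hpos]
      linarith [sq (x ⬝ᵥ v), mul_comm (A⁻¹ *ᵥ x ⬝ᵥ x) (v ⬝ᵥ A *ᵥ v), dotProduct_comm (A⁻¹ *ᵥ x) x,
        congrArg (fun z => (v ⬝ᵥ A *ᵥ v) * z) (dotProduct_comm (A⁻¹ *ᵥ x) x), congrArg (fun z => z * z) (dotProduct_comm x v)]
  have h := trace_mul_nonneg hW hR
  rw [sub_mul, Matrix.trace_sub, Matrix.smul_mul, Matrix.trace_smul,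
    Matrix.trace_mul_comm (Matrix.vecMulVec v v) R, trace_mul_vecMulVec, sub_nonneg, smul_eq_mul, inv_mul_le_iff₀ hpos] at h
  linarith

end

/-! ### The SR1 and BFGS updates -/

section

variable {n : Type*} [Fintype n] {d : ℕ}

/-- The sandwich `A ⪯ G ⪯ η A` for a symmetric matrix `G`, expressed by quadratic forms. -/
structure Sandwich (A G : Matrix n n ℝ) (η : ℝ) : Prop where
  symm : G.IsHermitian
  lower : ∀ v, v ⬝ᵥ A *ᵥ v ≤ v ⬝ᵥ G *ᵥ v
  upper : ∀ v, v ⬝ᵥ G *ᵥ v ≤ η * (v ⬝ᵥ A *ᵥ v)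

theorem Sandwich.posDef {A G : Matrix n n ℝ} {η : ℝ} (h : Sandwich A G η) (hA : A.PosDef) :
    G.PosDef :=
  Matrix.PosDef.of_dotProduct_mulVec_pos h.symm fun v hv => by
    simpa using (form_pos hA hv).trans_le (h.lower v)

theorem Sandwich.posSemidef_sub {A G : Matrix n n ℝ} {η : ℝ} (h : Sandwich A G η)
    (hA : A.PosDef) : (G - A).PosSemidef :=
  posSemidef_of_form_nonneg (h.symm.sub hA.isHermitian) fun v => by
    rw [Matrix.sub_mulVec, dotProduct_sub, sub_nonneg]
    exact h.lower v

theorem Sandwich.mono {A G : Matrix n n ℝ} {η η' : ℝ} (h : Sandwich A G η) (hA : A.PosDef)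
    (hη : η ≤ η') : Sandwich A G η' :=
  ⟨h.symm, h.lower, fun v => (h.upper v).trans
    (mul_le_mul_of_nonneg_right hη (form_nonneg hA.posSemidef v))⟩

theorem isHermitian_outer_self (a : Vec d) : (outer a a).IsHermitian :=
  isHermitian_vecMulVec_self a.ofLp

theorem form_smul_outer_self (c : ℝ) (a : Vec d) (v : Fin d → ℝ) :
    v ⬝ᵥ (c • outer a a) *ᵥ v = c * (v ⬝ᵥ a.ofLp) ^ 2 := by
  rw [form_smul, outer, form_vecMulVec, dotProduct_comm a.ofLp v, sq]

theorem inv_mul_sq_le {a b c : ℝ} (ha : 0 ≤ a) (hb : 0 ≤ b) (h : c ^ 2 ≤ a * b) :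
    a⁻¹ * c ^ 2 ≤ b := by
  rcases ha.eq_or_lt with rfl | ha
  · simpa using hb
  · rwa [inv_mul_le_iff₀ ha]

/-- The SR1 update subtracts from `G - A` a rank-one part that Cauchy–Schwarz keeps below it. If
`uᵀ (G - A) u = 0`, the convention `0⁻¹ = 0` makes the estimates hold as well. -/
theorem Sandwich.sr1 {A G : Mat d} {η : ℝ} (hA : A.PosDef) (h : Sandwich A G η) (u : Vec d) :
    Sandwich A (sr1 G A u) η := by
  have hR := h.posSemidef_sub hA
  unfold QuasiNewton.sr1
  split_ifs
  · exact h
  refine ⟨h.symm.sub (isHermitian_real_smul (isHermitian_outer_self _) _), fun v => ?_, fun v => ?_⟩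
  · rw [Matrix.sub_mulVec, dotProduct_sub, form_smul_outer_self]
    have h1 := cauchy_schwarz_form hR u.ofLp v
    rw [bilin_comm hR.isHermitian] at h1
    have h2 := inv_mul_sq_le (form_nonneg hR _) (form_nonneg hR _) h1
    rw [Matrix.sub_mulVec _ _ v, dotProduct_sub v] at h2
    simp only [app, quad] at h2 ⊢
    linarith
  · rw [Matrix.sub_mulVec, dotProduct_sub, form_smul_outer_self]
    have : 0 ≤ (quad (G - A) u)⁻¹ * (v ⬝ᵥ (app (G - A) u).ofLp) ^ 2 :=
      mul_nonneg (inv_nonneg.2 (form_nonneg hR _)) (sq_nonneg _)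
    linarith [h.upper v]

theorem form_bfgs (G A : Mat d) (u : Vec d) (v : Fin d → ℝ) :
    v ⬝ᵥ bfgs G A u *ᵥ v = v ⬝ᵥ G *ᵥ v
      - (u.ofLp ⬝ᵥ G *ᵥ u.ofLp)⁻¹ * (v ⬝ᵥ G *ᵥ u.ofLp) ^ 2
      + (u.ofLp ⬝ᵥ A *ᵥ u.ofLp)⁻¹ * (v ⬝ᵥ A *ᵥ u.ofLp) ^ 2 := by
  rw [bfgs, Matrix.add_mulVec, dotProduct_add, Matrix.sub_mulVec, dotProduct_sub,
    form_smul_outer_self, form_smul_outer_self]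
  rfl

theorem form_sub_le_form_add_smul {G : Matrix n n ℝ} (hG : G.IsHermitian) {u : n → ℝ}
    (hu : 0 < u ⬝ᵥ G *ᵥ u) (v : n → ℝ) (t : ℝ) :
    v ⬝ᵥ G *ᵥ v - (u ⬝ᵥ G *ᵥ u)⁻¹ * (v ⬝ᵥ G *ᵥ u) ^ 2 ≤ (v + t • u) ⬝ᵥ G *ᵥ (v + t • u) := by
  rw [form_add_smul hG]
  have : 0 ≤ (u ⬝ᵥ G *ᵥ u)⁻¹ * (t * (u ⬝ᵥ G *ᵥ u) + v ⬝ᵥ G *ᵥ u) ^ 2 := by positivity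
  have e : (u ⬝ᵥ G *ᵥ u)⁻¹ * (t * (u ⬝ᵥ G *ᵥ u) + v ⬝ᵥ G *ᵥ u) ^ 2
    = t ^ 2 * (u ⬝ᵥ G *ᵥ u) + 2 * t * (v ⬝ᵥ G *ᵥ u)
      + (u ⬝ᵥ G *ᵥ u)⁻¹ * (v ⬝ᵥ G *ᵥ u) ^ 2 := by
    field_simp
    ring
  linarith

theorem form_add_smul_of_eq {G : Matrix n n ℝ} (hG : G.IsHermitian) {u : n → ℝ}
    (hu : 0 < u ⬝ᵥ G *ᵥ u) (v : n → ℝ) :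
    (v + (-((u ⬝ᵥ G *ᵥ u)⁻¹ * (v ⬝ᵥ G *ᵥ u))) • u) ⬝ᵥ G *ᵥ
      (v + (-((u ⬝ᵥ G *ᵥ u)⁻¹ * (v ⬝ᵥ G *ᵥ u))) • u) =
    v ⬝ᵥ G *ᵥ v - (u ⬝ᵥ G *ᵥ u)⁻¹ * (v ⬝ᵥ G *ᵥ u) ^ 2 := by
  rw [form_add_smul hG]
  field_simp
  ring

/-- The form `vᵀ G v - (vᵀ G u)² / (uᵀ G u)` is the minimum of the form of `G` on the line
`v + ℝ u`; such minima inherit inequalities between forms. -/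
theorem Sandwich.bfgs {A G : Mat d} {η : ℝ} (hA : A.PosDef) (h : Sandwich A G η) (hη : 1 ≤ η)
    {u : Vec d} (hu : u ≠ 0) : Sandwich A (bfgs G A u) η := by
  have hu' : u.ofLp ≠ 0 := by simpa using hu
  have hAu := form_pos hA hu'
  have hGu := form_pos (h.posDef hA) hu'
  refine ⟨(h.symm.sub (isHermitian_real_smul (isHermitian_outer_self _) _)).add
    (isHermitian_real_smul (isHermitian_outer_self _) _), fun v => ?_, fun v => ?_⟩
  · rw [form_bfgs]
    have h1 := form_sub_le_form_add_smul hA.isHermitian hAu v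
      (-((u.ofLp ⬝ᵥ G *ᵥ u.ofLp)⁻¹ * (v ⬝ᵥ G *ᵥ u.ofLp)))
    have h2 := h.lower (v + (-((u.ofLp ⬝ᵥ G *ᵥ u.ofLp)⁻¹ * (v ⬝ᵥ G *ᵥ u.ofLp))) • u.ofLp)
    rw [form_add_smul_of_eq h.symm hGu] at h2
    linarith
  · rw [form_bfgs]
    have h1 := form_sub_le_form_add_smul h.symm hGu v
      (-((u.ofLp ⬝ᵥ A *ᵥ u.ofLp)⁻¹ * (v ⬝ᵥ A *ᵥ u.ofLp)))
    have h2 := h.upper (v + (-((u.ofLp ⬝ᵥ A *ᵥ u.ofLp)⁻¹ * (v ⬝ᵥ A *ᵥ u.ofLp))) • u.ofLp)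
    rw [form_add_smul_of_eq hA.isHermitian hAu] at h2
    have h3 : 0 ≤ (u.ofLp ⬝ᵥ A *ᵥ u.ofLp)⁻¹ * (v ⬝ᵥ A *ᵥ u.ofLp) ^ 2 := by positivity
    nlinarith

theorem dotProduct_self_eq_norm_sq (u : Vec d) : u.ofLp ⬝ᵥ u.ofLp = ‖u‖ ^ 2 := by
  rw [EuclideanSpace.real_norm_sq_eq]
  simp [dotProduct, sq]

/-- The rank-one SR1 correction removes at least the Rayleigh quotient of `G - A` along `u`. -/
theorem trace_sr1_sub_le {A G : Mat d} (hR : (G - A).PosSemidef) {u : Vec d} (hu : ‖u‖ = 1) :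
    (sr1 G A u - A).trace ≤ (G - A).trace - quad (G - A) u := by
  unfold sr1
  split_ifs with he
  · have : quad (G - A) u = 0 := by
      have he' : G *ᵥ u.ofLp = A *ᵥ u.ofLp := congrArg WithLp.ofLp he
      rw [quad, Matrix.sub_mulVec, he', sub_self, dotProduct_zero]
    rw [this, sub_zero]
  · rw [sub_right_comm, Matrix.trace_sub _ (_ • _), Matrix.trace_smul, outer,
      Matrix.trace_vecMulVec, smul_eq_mul]
    have hCS := cauchy_schwarz_form (Matrix.PosSemidef.one (n := Fin d) (R := ℝ)) u.ofLp
      ((G - A) *ᵥ u.ofLp)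
    simp only [Matrix.one_mulVec] at hCS
    rw [dotProduct_self_eq_norm_sq u, hu] at hCS
    have h0 : 0 ≤ quad (G - A) u := form_nonneg hR _
    rcases h0.eq_or_lt with h0 | h0
    · rw [← h0]; simp
    · have : quad (G - A) u ≤ (quad (G - A) u)⁻¹ *
          ((app (G - A) u).ofLp ⬝ᵥ (app (G - A) u).ofLp) := by
        rw [le_inv_mul_iff₀ h0, ← sq]
        simpa [quad, app] using hCS
      linarith

theorem trace_inv_mul_self {A : Matrix n n ℝ} [DecidableEq n] (hA : A.PosDef) :
    (A⁻¹ * A).trace = Fintype.card n := by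
  rw [inv_mul_of_posDef hA, Matrix.trace_one]

theorem ne_zero_of_norm_eq_one {w : Vec d} (hw : ‖w‖ = 1) : w ≠ 0 :=
  norm_ne_zero_iff.1 (by rw [hw]; exact one_ne_zero)

theorem app_transpose_ne_zero {F G : Mat d} (hF : Fᵀ * F * G = 1) {w : Vec d} (hw : w ≠ 0) :
    app Fᵀ w ≠ 0 := by
  intro h0
  have h1 : Fᵀ * (F * G) = 1 := by rw [← mul_assoc, hF]
  have h2 : F * G * Fᵀ = 1 := mul_eq_one_comm.1 h1
  have h3 : Fᵀ *ᵥ w.ofLp = 0 := congrArg WithLp.ofLp h0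
  have h4 : w.ofLp = 0 := by
    rw [← Matrix.one_mulVec w.ofLp, ← h2, ← Matrix.mulVec_mulVec, h3, Matrix.mulVec_zero]
  exact hw (by simpa using h4)

/-- With the scaling `u = Fᵀ w`, `Fᵀ F = G⁻¹`, the decrease of the potential `tr (A⁻¹ (G - A))`
under the BFGS update is a quadratic form in the unit vector `w`; by `trace_inv_conj` the trace of
its matrix is the potential itself. -/
theorem trace_bfgs {A G F : Mat d} (hA : A.PosDef) (hF : Fᵀ * F * G = 1) {w : Vec d}
    (hw : ‖w‖ = 1) :
    (A⁻¹ * (bfgs G A (app Fᵀ w) - A)).trace =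
      (A⁻¹ * (G - A)).trace - (quad ((F⁻¹)ᵀ * A⁻¹ * F⁻¹) w - 1) := by
  have hFu : IsUnit F.det := by
    have := congrArg Matrix.det hF
    rw [Matrix.det_mul, Matrix.det_mul, Matrix.det_one] at this
    refine isUnit_iff_ne_zero.2 fun h0 => ?_
    simp [h0] at this
  have hG : G * Fᵀ = F⁻¹ := by
    have h1 : G * (Fᵀ * F) = 1 := mul_eq_one_comm.1 hF
    calc G * Fᵀ = G * (Fᵀ * F) * F⁻¹ := by
          rw [mul_assoc, mul_assoc, Matrix.mul_nonsing_inv _ hFu, mul_one]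
      _ = F⁻¹ := by rw [h1, one_mul]
  have hgu : G *ᵥ (Fᵀ *ᵥ w.ofLp) = F⁻¹ *ᵥ w.ofLp := by rw [Matrix.mulVec_mulVec, hG]
  have hww : w.ofLp ⬝ᵥ w.ofLp = 1 := by rw [dotProduct_self_eq_norm_sq, hw, one_pow]
  have hGu : quad G (app Fᵀ w) = 1 := by
    simp only [quad, app]
    rw [hgu, Matrix.mulVec_transpose, ← Matrix.dotProduct_mulVec, Matrix.mulVec_mulVec,
      Matrix.mul_nonsing_inv _ hFu, Matrix.one_mulVec, hww]
  have hw0 : w ≠ 0 := ne_zero_of_norm_eq_one hw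
  have hu0 : Fᵀ *ᵥ w.ofLp ≠ 0 := by simpa [app] using app_transpose_ne_zero hF hw0
  have hAu : quad A (app Fᵀ w) ≠ 0 := (form_pos hA hu0).ne'
  have e : bfgs G A (app Fᵀ w) - A = (G - A) - outer (app G (app Fᵀ w)) (app G (app Fᵀ w))
      + (quad A (app Fᵀ w))⁻¹ • outer (app A (app Fᵀ w)) (app A (app Fᵀ w)) := by
    rw [bfgs, hGu, inv_one, one_smul]
    abel
  rw [e, mul_add, mul_sub, Matrix.trace_add, Matrix.trace_sub, Matrix.mul_smul,
    Matrix.trace_smul, outer, outer, trace_mul_vecMulVec, trace_mul_vecMulVec]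
  have e1 : (app A (app Fᵀ w)).ofLp ⬝ᵥ A⁻¹ *ᵥ (app A (app Fᵀ w)).ofLp = quad A (app Fᵀ w) := by
    simp only [app, quad]
    rw [inv_mulVec_mulVec hA, dotProduct_comm]
  have e2 : (app G (app Fᵀ w)).ofLp ⬝ᵥ A⁻¹ *ᵥ (app G (app Fᵀ w)).ofLp
      = quad ((F⁻¹)ᵀ * A⁻¹ * F⁻¹) w := by
    simp only [app, quad]
    rw [hgu, ← Matrix.mulVec_mulVec, ← Matrix.mulVec_mulVec, Matrix.mulVec_transpose,
      ← Matrix.mulVec_transpose, Matrix.dotProduct_mulVec w.ofLp, Matrix.vecMul_transpose]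
  rw [e1, e2, smul_eq_mul, inv_mul_cancel₀ hAu]
  ring

theorem trace_inv_conj {A G F : Mat d} (hA : A.PosDef) (hF : Fᵀ * F * G = 1) :
    ((F⁻¹)ᵀ * A⁻¹ * F⁻¹ - 1).trace = (A⁻¹ * (G - A)).trace := by
  have hG : F⁻¹ * (F⁻¹)ᵀ = G := by
    rw [Matrix.transpose_nonsing_inv, ← Matrix.mul_inv_rev]
    exact Matrix.inv_eq_right_inv hF
  rw [Matrix.trace_sub, mul_sub, Matrix.trace_sub, inv_mul_of_posDef hA, mul_assoc,
    Matrix.trace_mul_comm, mul_assoc, hG]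

/-- The factor update keeps `Fᵀ F` inverse to the matrix `G`. -/
theorem factorUpdate_invariant {A G F : Mat d} (hA : A.PosDef) (hG : G.PosDef)
    (hF : Fᵀ * F * G = 1) {w : Vec d} (hw : w ≠ 0) :
    (factorUpdate F A w)ᵀ * factorUpdate F A w * bfgs G A (app Fᵀ w) = 1 := by
  obtain ⟨u, hu⟩ : ∃ u, u = Fᵀ *ᵥ w.ofLp := ⟨_, rfl⟩
  have hu0 : u ≠ 0 := by simpa [hu, app] using app_transpose_ne_zero hF hw
  have hc := form_pos hA hu0
  have he := form_pos hG hu0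
  obtain ⟨a, ha⟩ : ∃ a, a = A *ᵥ u := ⟨_, rfl⟩
  obtain ⟨g, hg⟩ : ∃ g, g = G *ᵥ u := ⟨_, rfl⟩
  obtain ⟨c, hcdef⟩ : ∃ c, c = u ⬝ᵥ A *ᵥ u := ⟨_, rfl⟩
  obtain ⟨e, hedef⟩ : ∃ e, e = u ⬝ᵥ G *ᵥ u := ⟨_, rfl⟩
  obtain ⟨s, hs⟩ : ∃ s, s = Real.sqrt c / ‖w‖ := ⟨_, rfl⟩
  obtain ⟨v, hv⟩ : ∃ v, v = s • w.ofLp := ⟨_, rfl⟩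
  rw [← hcdef] at hc
  rw [← hedef] at he
  have hfac : factorUpdate F A w = F - c⁻¹ • Matrix.vecMulVec (F *ᵥ a - v) u := by
    rw [hv, hs, ha, hcdef, hu]
    rfl
  have hbf : bfgs G A (app Fᵀ w) = G - e⁻¹ • Matrix.vecMulVec g g
      + c⁻¹ • Matrix.vecMulVec a a := by
    rw [ha, hg, hcdef, hedef, hu]
    rfl
  have hGs : Gᵀ = G := hG.isHermitian
  have huA : u ⬝ᵥ a = c := by rw [hcdef, ha]
  have hug : u ⬝ᵥ g = e := by rw [hedef, hg]
  have huG : u ᵥ* G = g := by rw [hg, ← Matrix.mulVec_transpose, hGs]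
  have hFv : Fᵀ *ᵥ v = s • u := by rw [hv, Matrix.mulVec_smul, hu]
  have hFFg : Fᵀ *ᵥ (F *ᵥ g) = u := by
    rw [Matrix.mulVec_mulVec, hg, Matrix.mulVec_mulVec, hF, Matrix.one_mulVec]
  have hvv : v ⬝ᵥ v = c := by
    rw [hv, smul_dotProduct, dotProduct_smul, dotProduct_self_eq_norm_sq, hs]
    have : ‖w‖ ≠ 0 := norm_ne_zero_iff.2 hw
    simp only [smul_eq_mul]
    field_simp
    exact Real.sq_sqrt hc.le
  -- The row vector `uᵀ` times the updated matrix is `aᵀ`.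
  have hsec : u ᵥ* bfgs G A (app Fᵀ w) = a := by
    rw [hbf, Matrix.vecMul_add, Matrix.vecMul_sub, Matrix.vecMul_smul, Matrix.vecMul_smul,
      Matrix.vecMul_vecMulVec, Matrix.vecMul_vecMulVec, hug, huA, huG, smul_smul, smul_smul,
      inv_mul_cancel₀ he.ne', inv_mul_cancel₀ hc.ne']
    simp
  have hprod : factorUpdate F A w * bfgs G A (app Fᵀ w) =
      F * G - e⁻¹ • Matrix.vecMulVec (F *ᵥ g) g + c⁻¹ • Matrix.vecMulVec v a := by
    rw [hfac, sub_mul, Matrix.smul_mul, Matrix.vecMulVec_mul, hsec, hbf, mul_add, mul_sub,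
      Matrix.mul_smul, Matrix.mul_smul, Matrix.mul_vecMulVec, Matrix.mul_vecMulVec,
      Matrix.sub_vecMulVec, smul_sub]
    abel
  have hrow1 : (F *ᵥ a - v) ᵥ* (F * G) = a - s • g := by
    rw [Matrix.sub_vecMul, ← Matrix.vecMul_vecMul, ← Matrix.vecMul_vecMul,
      ← Matrix.vecMul_transpose, Matrix.vecMul_vecMul, Matrix.vecMul_vecMul, ← mul_assoc, hF,
      Matrix.vecMul_one, ← Matrix.mulVec_transpose F, hFv, Matrix.smul_vecMul, huG]
  have hrow2 : (F *ᵥ a - v) ⬝ᵥ (F *ᵥ g) = c - s * e := by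
    rw [sub_dotProduct, dotProduct_comm (F *ᵥ a), Matrix.dotProduct_mulVec (F *ᵥ g),
      Matrix.dotProduct_mulVec v, ← Matrix.mulVec_transpose, ← Matrix.mulVec_transpose, hFFg, hFv,
      huA, smul_dotProduct, hug, smul_eq_mul]
  have hrow3 : (F *ᵥ a - v) ⬝ᵥ v = s * c - c := by
    rw [sub_dotProduct, hvv, dotProduct_comm, Matrix.dotProduct_mulVec, ← Matrix.mulVec_transpose,
      hFv, smul_dotProduct, huA, smul_eq_mul]
  rw [mul_assoc, hprod, hfac, Matrix.transpose_sub, Matrix.transpose_smul,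
    Matrix.transpose_vecMulVec, sub_mul, Matrix.smul_mul, Matrix.vecMulVec_mul, Matrix.vecMul_add,
    Matrix.vecMul_sub, Matrix.vecMul_smul, Matrix.vecMul_smul, Matrix.vecMul_vecMulVec,
    Matrix.vecMul_vecMulVec, hrow1, hrow2, hrow3, mul_add, mul_sub, ← mul_assoc, hF,
    Matrix.mul_smul, Matrix.mul_smul, Matrix.mul_vecMulVec, Matrix.mul_vecMulVec, hFFg, hFv]
  ext i j
  simp only [Matrix.sub_apply, Matrix.add_apply, Matrix.smul_apply, Matrix.vecMulVec_apply,
    Pi.smul_apply, Pi.sub_apply, Pi.add_apply, smul_eq_mul]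
  field_simp
  ring

theorem quad_stdVec (Q : Mat d) (i : Fin d) : quad Q (stdVec i) = Q i i := by
  simp [quad, stdVec, EuclideanSpace.single]

theorem norm_stdVec (i : Fin d) : ‖(stdVec i : Vec d)‖ = 1 := by
  simp [stdVec]

theorem IsArgmaxStdVec.norm_eq_one {q : Vec d → ℝ} {u : Vec d} (h : IsArgmaxStdVec q u) :
    ‖u‖ = 1 := by
  obtain ⟨i, rfl, -⟩ := h
  exact norm_stdVec i

theorem IsArgmaxStdVec.trace_le {Q : Mat d} {u : Vec d} (h : IsArgmaxStdVec (quad Q) u) :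
    Q.trace ≤ d * quad Q u := by
  obtain ⟨i, rfl, hi⟩ := h
  calc Q.trace = ∑ j, quad Q (stdVec j) := by simp [Matrix.trace, quad_stdVec]
    _ ≤ ∑ _j : Fin d, quad Q (stdVec i) := Finset.sum_le_sum fun j _ => hi j
    _ = d * quad Q (stdVec i) := by simp

end

/-! ### One quasi-Newton step -/

section

variable {d : ℕ} {f : Vec d → ℝ} {M μ L : ℝ}

theorem sum_smul_stdVec (a : Vec d) : ∑ i, a i • stdVec i = a := by
  ext j
  simp [stdVec, EuclideanSpace.single, Finset.sum_apply, Pi.single_apply]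

theorem fderiv_fderiv_eq_form (f : Vec d → ℝ) (x a b : Vec d) :
    fderiv ℝ (fderiv ℝ f) x a b = a.ofLp ⬝ᵥ hess f x *ᵥ b.ofLp := by
  conv_lhs => rw [← sum_smul_stdVec a, ← sum_smul_stdVec b]
  simp only [map_sum, map_smul, sum_apply, smul_apply, smul_eq_mul, dotProduct, Matrix.mulVec,
    hess, Matrix.of_apply, Finset.mul_sum]
  rw [Finset.sum_comm]
  exact Finset.sum_congr rfl fun i _ => Finset.sum_congr rfl fun j _ => by ring

theorem dotProduct_gradient (f : Vec d → ℝ) (x v : Vec d) :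
    v.ofLp ⬝ᵥ (gradient f x).ofLp = fderiv ℝ f x v := by
  rw [← InnerProductSpace.toDual_symm_apply (𝕜 := ℝ) (E := Vec d),
    EuclideanSpace.inner_eq_star_dotProduct]
  simp [gradient]

/-- The mean value theorem for `t ↦ vᵀ ∇f(x + t h)`. -/
theorem exists_gradient_sub_eq (hf : TwiceDifferentiable f) (x h v : Vec d) :
    ∃ ξ ∈ Set.Ioo (0 : ℝ) 1, v.ofLp ⬝ᵥ (gradient f (x + h)).ofLp - v.ofLp ⬝ᵥ (gradient f x).ofLp
      = h.ofLp ⬝ᵥ hess f (x + ξ • h) *ᵥ v.ofLp := by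
  have hder : ∀ t : ℝ, HasDerivAt (fun t : ℝ => fderiv ℝ f (x + t • h) v)
      (fderiv ℝ (fderiv ℝ f) (x + t • h) h v) t := by
    intro t
    have h1 : HasDerivAt (fun t : ℝ => x + t • h) h t := by
      simpa using ((hasDerivAt_id t).smul_const h).const_add x
    have h2 := (hf.2 (x + t • h)).hasFDerivAt.comp_hasDerivAt t h1
    exact (ContinuousLinearMap.apply ℝ ℝ v).hasFDerivAt.comp_hasDerivAt t h2
  obtain ⟨ξ, hξ, he⟩ := exists_hasDerivAt_eq_slope (fun t : ℝ => fderiv ℝ f (x + t • h) v)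
    (fun t => fderiv ℝ (fderiv ℝ f) (x + t • h) h v) zero_lt_one
    (fun t _ => (hder t).continuousAt.continuousWithinAt) (fun t _ => hder t)
  refine ⟨ξ, hξ, ?_⟩
  rw [dotProduct_gradient, dotProduct_gradient, ← fderiv_fderiv_eq_form, he]
  simp

theorem normOf_sq {A : Mat d} (hA : A.PosSemidef) (v : Vec d) :
    normOf A v ^ 2 = v.ofLp ⬝ᵥ A *ᵥ v.ofLp :=
  Real.sq_sqrt (form_nonneg hA _)

theorem normOf_nonneg (A : Mat d) (v : Vec d) : 0 ≤ normOf A v := Real.sqrt_nonneg _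

theorem normOf_smul (A : Mat d) {c : ℝ} (hc : 0 ≤ c) (v : Vec d) :
    normOf A (c • v) = c * normOf A v := by
  have : quad A (c • v) = c ^ 2 * quad A v := by
    simp only [quad, WithLp.ofLp_smul, Matrix.mulVec_smul, smul_dotProduct, dotProduct_smul,
      smul_eq_mul]
    ring
  rw [normOf, this, Real.sqrt_mul (sq_nonneg c), Real.sqrt_sq hc, normOf]

theorem normOf_neg (A : Mat d) (v : Vec d) : normOf A (-v) = normOf A v := by
  simp [normOf, quad, Matrix.mulVec_neg]

theorem lam_nonneg (f : Vec d → ℝ) (x : Vec d) : 0 ≤ lam f x := normOf_nonneg _ _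

theorem form_le_of_loewnerLE {A B : Mat d} (h : LoewnerLE A B) (v : Fin d → ℝ) :
    v ⬝ᵥ A *ᵥ v ≤ v ⬝ᵥ B *ᵥ v := by
  have := form_nonneg h v
  rwa [Matrix.sub_mulVec, dotProduct_sub, sub_nonneg] at this

theorem StronglyConvexSmooth.form_lower (h : StronglyConvexSmooth μ L f) (x : Vec d)
    (v : Fin d → ℝ) : μ * (v ⬝ᵥ v) ≤ v ⬝ᵥ hess f x *ᵥ v := by
  simpa [form_smul] using form_le_of_loewnerLE (h.lower x) v

theorem StronglyConvexSmooth.form_upper (h : StronglyConvexSmooth μ L f) (x : Vec d)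
    (v : Fin d → ℝ) : v ⬝ᵥ hess f x *ᵥ v ≤ L * (v ⬝ᵥ v) := by
  simpa [form_smul] using form_le_of_loewnerLE (h.upper x) v

theorem StronglyConvexSmooth.posDef (h : StronglyConvexSmooth μ L f) (x : Vec d) :
    (hess f x).PosDef := by
  have hH : (hess f x).IsHermitian := by
    have h1 := (h.lower x).isHermitian.add
      (isHermitian_real_smul (Matrix.isHermitian_one (n := Fin d) (α := ℝ)) μ)
    rwa [sub_add_cancel] at h1
  refine Matrix.PosDef.of_dotProduct_mulVec_pos hH fun v hv => ?_
  have h1 : 0 < v ⬝ᵥ v := by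
    simpa using (Matrix.dotProduct_star_self_pos_iff (v := v)).2 hv
  simpa using (mul_pos h.mu_pos h1).trans_le (h.form_lower x v)

theorem StronglySelfConcordant.form_le (h : StronglySelfConcordant M f) (x y z w : Vec d)
    (v : Fin d → ℝ) : v ⬝ᵥ hess f y *ᵥ v ≤
      v ⬝ᵥ hess f x *ᵥ v + M * normOf (hess f z) (y - x) * (v ⬝ᵥ hess f w *ᵥ v) := by
  have := form_le_of_loewnerLE (h.hess_close x y z w) v
  rw [Matrix.sub_mulVec, dotProduct_sub, form_smul] at this
  linarith

theorem lam_sq (hf : StronglyConvexSmooth μ L f) (x : Vec d) :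
    lam f x ^ 2 = (gradient f x).ofLp ⬝ᵥ (hess f x)⁻¹ *ᵥ (gradient f x).ofLp :=
  normOf_sq (hf.posDef x).inv.posSemidef _

theorem nextPoint_sub (f : Vec d → ℝ) (x : Vec d) (G : Mat d) :
    nextPoint f x G - x = -app G⁻¹ (gradient f x) := by
  simp [nextPoint]

theorem normOf_step_le_lam (hf : StronglyConvexSmooth μ L f) {x : Vec d} {G : Mat d} {η : ℝ}
    (h : Sandwich (hess f x) G η) : normOf (hess f x) (nextPoint f x G - x) ≤ lam f x := by
  have hH := hf.posDef x
  have hG := h.posDef hH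
  refine le_of_sq_le_sq ?_ (lam_nonneg f x)
  rw [nextPoint_sub, normOf_neg, normOf_sq hH.posSemidef, lam_sq hf]
  refine (h.lower _).trans ?_
  simp only [app]
  rw [mulVec_inv_mulVec hG, dotProduct_comm]
  simpa using form_inv_le hH hG one_pos (by simpa using h.lower) (gradient f x).ofLp

theorem one_le_corr (hM : 0 ≤ M) (x : Vec d) (G : Mat d) : 1 ≤ corr f M x G := by
  have := normOf_nonneg (hess f x) (nextPoint f x G - x)
  rw [corr]
  nlinarith [mul_nonneg hM this]

theorem corr_sub_one_le (hsc : StronglySelfConcordant M f) (hf : StronglyConvexSmooth μ L f)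
    {x : Vec d} {G : Mat d} {η : ℝ} (h : Sandwich (hess f x) G η) :
    corr f M x G - 1 ≤ M * lam f x := by
  rw [corr, add_sub_cancel_left]
  exact mul_le_mul_of_nonneg_left (normOf_step_le_lam hf h) hsc.M_pos.le

/-- Consecutive Hessians differ by at most the correction factor, in either direction. -/
theorem hess_next_le (hsc : StronglySelfConcordant M f) (x : Vec d) (G : Mat d) (v : Fin d → ℝ) :
    v ⬝ᵥ hess f (nextPoint f x G) *ᵥ v ≤ corr f M x G * (v ⬝ᵥ hess f x *ᵥ v) := by
  have := hsc.form_le x (nextPoint f x G) x x v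
  rw [corr]
  linarith

theorem hess_le_next (hsc : StronglySelfConcordant M f) (x : Vec d) (G : Mat d) (v : Fin d → ℝ) :
    v ⬝ᵥ hess f x *ᵥ v ≤ corr f M x G * (v ⬝ᵥ hess f (nextPoint f x G) *ᵥ v) := by
  have := hsc.form_le (nextPoint f x G) x x (nextPoint f x G) v
  rw [← neg_sub (nextPoint f x G) x, normOf_neg] at this
  rw [corr]
  linarith

/-- The corrected matrix dominates the Hessian at the next point. -/
theorem Sandwich.corrected (hsc : StronglySelfConcordant M f)
    {x : Vec d} {G : Mat d} {η : ℝ} (hη : 0 ≤ η) (h : Sandwich (hess f x) G η) :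
    Sandwich (hess f (nextPoint f x G)) (corr f M x G • G) (corr f M x G ^ 2 * η) := by
  have hc := one_le_corr (f := f) hsc.M_pos.le x G
  have hc0 : 0 ≤ corr f M x G := by linarith
  refine ⟨isHermitian_real_smul h.symm _, fun v => ?_, fun v => ?_⟩
  · rw [form_smul]
    exact (hess_next_le hsc x G v).trans (mul_le_mul_of_nonneg_left (h.lower v) hc0)
  · rw [form_smul]
    calc _ ≤ corr f M x G * (η * (v ⬝ᵥ hess f x *ᵥ v)) :=
          mul_le_mul_of_nonneg_left (h.upper v) hc0
      _ ≤ corr f M x G * (η * (corr f M x G * (v ⬝ᵥ hess f (nextPoint f x G) *ᵥ v))) := by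
          gcongr
          exact hess_le_next hsc x G v
      _ = _ := by ring

/-- One quasi-Newton step: with `a = M r` and `∇²f(x) ⪯ G ⪯ η ∇²f(x)`,
`λ_f(x₊) ≤ (1 + a/2) (η - 1 + a) / η · λ_f(x)`. In place of the averaged Hessian, the proof uses
the Hessian `K` at one intermediate point, which the mean value theorem supplies for the
direction `∇²f(x₊)⁻¹ ∇f(x₊)`. -/
theorem lam_nextPoint_le (hsc : StronglySelfConcordant M f) (hf : StronglyConvexSmooth μ L f)
    {x : Vec d} {G : Mat d} {η a : ℝ} (hη : 1 ≤ η) (h : Sandwich (hess f x) G η)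
    (ha : a = corr f M x G - 1) (ha1 : a ≤ 1) :
    lam f (nextPoint f x G) ≤ (1 + a / 2) * ((η - 1 + a) / η) * lam f x := by
  have hr : M * normOf (hess f x) (nextPoint f x G - x) = a := by rw [ha, corr]; ring
  have ha0 : 0 ≤ a := by
    have := one_le_corr (f := f) hsc.M_pos.le x G
    linarith
  have hH := hf.posDef x
  have hG := h.posDef hH
  obtain ⟨y, hy⟩ : ∃ y, y = nextPoint f x G := ⟨_, rfl⟩
  rw [← hy] at hr ⊢
  have hHy := hf.posDef y
  have hxy : x + (y - x) = y := by abel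
  obtain ⟨ξ, ⟨hξ0, hξ1⟩, hmv⟩ := exists_gradient_sub_eq hf.twice_diff x (y - x)
    (app (hess f y)⁻¹ (gradient f y))
  rw [hxy] at hmv
  obtain ⟨z, hz⟩ : ∃ z, z = x + ξ • (y - x) := ⟨_, rfl⟩
  rw [← hz] at hmv
  have hK := hf.posDef z
  obtain ⟨K, hKdef⟩ : ∃ K, K = hess f z := ⟨_, rfl⟩
  obtain ⟨g, hg⟩ : ∃ g, g = (gradient f x).ofLp := ⟨_, rfl⟩
  obtain ⟨v, hv⟩ : ∃ v, v = (hess f y)⁻¹ *ᵥ (gradient f y).ofLp := ⟨_, rfl⟩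
  rw [← hKdef] at hK hmv
  have hzx : z - x = ξ • (y - x) := by rw [hz]; abel
  have hyz : y - z = (1 - ξ) • (y - x) := by rw [hz, sub_smul, one_smul]; abel
  have hrzx : M * normOf (hess f x) (z - x) = ξ * a := by
    rw [hzx, normOf_smul _ hξ0.le, ← hr]; ring
  have hrxz : M * normOf (hess f x) (x - z) = ξ * a := by
    rw [← neg_sub z x, normOf_neg, hrzx]
  have hrzy : M * normOf (hess f x) (z - y) = (1 - ξ) * a := by
    rw [← neg_sub y z, normOf_neg, hyz, normOf_smul _ (by linarith), ← hr]; ring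
  have hξa : 0 ≤ ξ * a := mul_nonneg hξ0.le ha0
  have hξa' : 0 ≤ (1 - ξ) * a := mul_nonneg (by linarith) ha0
  -- Comparisons of `K` with the Hessians at the two endpoints.
  have hKH : ∀ w : Fin d → ℝ, w ⬝ᵥ K *ᵥ w ≤ (1 + ξ * a) * (w ⬝ᵥ hess f x *ᵥ w) := fun w => by
    have := hsc.form_le x z x x w
    rw [hrzx, ← hKdef] at this
    linarith
  have hHK : ∀ w : Fin d → ℝ, w ⬝ᵥ hess f x *ᵥ w ≤ (1 + ξ * a) * (w ⬝ᵥ K *ᵥ w) := fun w => by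
    have := hsc.form_le z x x z w
    rw [hrxz, ← hKdef] at this
    linarith
  have hKy : ∀ w : Fin d → ℝ, w ⬝ᵥ K *ᵥ w ≤ (1 + (1 - ξ) * a) * (w ⬝ᵥ hess f y *ᵥ w) := fun w => by
    have := hsc.form_le y z x y w
    rw [hrzy, ← hKdef] at this
    linarith
  have hKG := form_inv_le hK hG (c := 1 + ξ * a) (by linarith)
    (fun w => (hKH w).trans (mul_le_mul_of_nonneg_left (h.lower w) (by linarith)))
  have hGK := form_inv_le hG hK (c := η * (1 + ξ * a)) (by positivity)
    (fun w => (h.upper w).trans (by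
      rw [mul_assoc]; exact mul_le_mul_of_nonneg_left (hHK w) (by linarith)))
  have hlamy : lam f y ^ 2 = v ⬝ᵥ (gradient f y).ofLp := by
    rw [lam_sq hf, hv, dotProduct_comm]
  have hvHv : v ⬝ᵥ hess f y *ᵥ v = lam f y ^ 2 := by
    rw [hlamy, hv, mulVec_inv_mulVec hHy]
  -- `λ_f(x₊)²` is the value at `v` and `K⁻¹ g` of the bilinear form of `K - K G⁻¹ K`.
  have hNH : (K - K * G⁻¹ * K).IsHermitian := by
    have hKt : Kᵀ = K := hK.isHermitian
    have hGt : (G⁻¹)ᵀ = G⁻¹ := hG.inv.isHermitian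
    refine hK.isHermitian.sub ?_
    rw [Matrix.IsHermitian, Matrix.conjTranspose_eq_transpose_of_trivial, Matrix.transpose_mul,
      Matrix.transpose_mul, hKt, hGt, mul_assoc]
  have hlamN : lam f y ^ 2 = v ⬝ᵥ (K - K * G⁻¹ * K) *ᵥ (K⁻¹ *ᵥ g) := by
    rw [Matrix.sub_mulVec, mulVec_inv_mulVec hK, ← Matrix.mulVec_mulVec, mulVec_inv_mulVec hK,
      ← Matrix.mulVec_mulVec, dotProduct_sub, hlamy]
    have e : (y - x).ofLp = -(G⁻¹ *ᵥ g) := by rw [hy, nextPoint_sub, hg]; rfl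
    rw [e, bilin_comm hK.isHermitian, Matrix.mulVec_neg, dotProduct_neg] at hmv
    rw [hv, hg]
    rw [hg] at hmv
    simp only [app] at hmv
    linarith
  have hρ : ∀ w : Fin d → ℝ, |w ⬝ᵥ (K - K * G⁻¹ * K) *ᵥ w| ≤ ((η - 1 + a) / η) * (w ⬝ᵥ K *ᵥ w) := by
    intro w
    have hw := form_nonneg hK.posSemidef w
    have e : w ⬝ᵥ (K - K * G⁻¹ * K) *ᵥ w = w ⬝ᵥ K *ᵥ w - (K *ᵥ w) ⬝ᵥ G⁻¹ *ᵥ (K *ᵥ w) := by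
      rw [Matrix.sub_mulVec, dotProduct_sub, ← Matrix.mulVec_mulVec, ← Matrix.mulVec_mulVec,
        bilin_comm hK.isHermitian w (G⁻¹ *ᵥ K *ᵥ w), dotProduct_comm (G⁻¹ *ᵥ _)]
    have e1 : (K *ᵥ w) ⬝ᵥ K⁻¹ *ᵥ (K *ᵥ w) = w ⬝ᵥ K *ᵥ w := by
      rw [inv_mulVec_mulVec hK, dotProduct_comm]
    have b1 := hKG (K *ᵥ w)
    have b2 := hGK (K *ᵥ w)
    rw [e1] at b1 b2
    have hη0 : 0 < η := by linarith
    rw [e, abs_le]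
    constructor
    · have : ξ * a ≤ (η - 1 + a) / η := by
        rw [le_div_iff₀ hη0]
        nlinarith [mul_nonneg (sub_nonneg.2 hη) (sub_nonneg.2 ha1),
          mul_nonneg (mul_nonneg ha0 hη0.le) (sub_nonneg.2 hξ1.le)]
      nlinarith
    · have hq : (1 - a) / η * (w ⬝ᵥ K *ᵥ w) ≤ (K *ᵥ w) ⬝ᵥ G⁻¹ *ᵥ (K *ᵥ w) := by
        have h1 : (1 - a) * (1 + ξ * a) ≤ 1 := by nlinarith [mul_nonneg ha0 (sub_nonneg.2 hξ1.le)]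
        have hGn := form_nonneg hG.inv.posSemidef (K *ᵥ w)
        rw [div_mul_eq_mul_div, div_le_iff₀ hη0]
        calc (1 - a) * (w ⬝ᵥ K *ᵥ w)
            ≤ (1 - a) * (η * (1 + ξ * a) * ((K *ᵥ w) ⬝ᵥ G⁻¹ *ᵥ (K *ᵥ w))) :=
              mul_le_mul_of_nonneg_left b2 (by linarith)
          _ = ((1 - a) * (1 + ξ * a)) * (((K *ᵥ w) ⬝ᵥ G⁻¹ *ᵥ (K *ᵥ w)) * η) := by ring
          _ ≤ 1 * (((K *ᵥ w) ⬝ᵥ G⁻¹ *ᵥ (K *ᵥ w)) * η) := by gcongr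
          _ = _ := one_mul _
      have e2 : (η - 1 + a) / η = 1 - (1 - a) / η := by field_simp; ring
      rw [e2]
      linarith
  have hsq := sq_bilin_le hNH hK.isHermitian hρ v (K⁻¹ *ᵥ g)
  rw [← hlamN, mulVec_inv_mulVec hK, dotProduct_comm _ g] at hsq
  have hp : g ⬝ᵥ K⁻¹ *ᵥ g ≤ (1 + ξ * a) * lam f x ^ 2 := by
    rw [lam_sq hf, ← hg]
    exact form_inv_le hH hK (by linarith) hHK g
  have hvK : v ⬝ᵥ K *ᵥ v ≤ (1 + (1 - ξ) * a) * lam f y ^ 2 := hvHv ▸ hKy v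
  have hρ0 : 0 ≤ (η - 1 + a) / η := div_nonneg (by linarith) (by linarith)
  have hfin : (lam f y ^ 2) ^ 2 ≤
      ((1 + a / 2) * ((η - 1 + a) / η) * lam f x) ^ 2 * lam f y ^ 2 := by
    calc (lam f y ^ 2) ^ 2 ≤ ((η - 1 + a) / η) ^ 2 *
          (((1 + (1 - ξ) * a) * lam f y ^ 2) * ((1 + ξ * a) * lam f x ^ 2)) := by
          refine hsq.trans ?_
          have := form_nonneg hK.inv.posSemidef g
          gcongr
      _ = ((1 + (1 - ξ) * a) * (1 + ξ * a)) *
          (((η - 1 + a) / η) ^ 2 * (lam f y ^ 2 * lam f x ^ 2)) := by ring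
      _ ≤ (1 + a / 2) ^ 2 * (((η - 1 + a) / η) ^ 2 * (lam f y ^ 2 * lam f x ^ 2)) := by
          gcongr
          nlinarith [sq_nonneg (a * (1 - 2 * ξ))]
      _ = _ := by ring
  rcases (lam_nonneg f y).eq_or_lt with h0 | h0
  · rw [← h0]
    have := lam_nonneg f x
    positivity
  · have hl := lam_nonneg f x
    refine le_of_sq_le_sq ?_ (by positivity)
    have h2 : 0 < lam f y ^ 2 := by positivity
    refine le_of_mul_le_mul_right ?_ h2
    rw [← sq]
    exact hfin

end

/-! ### Linear convergence and the Lyapunov function -/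

section

variable {d : ℕ} {f : Vec d → ℝ} {M μ L κ : ℝ} {x₀ : Vec d}

/-- The linear rate `1 - 1 / (2 κ)`. -/
def rate (κ : ℝ) : ℝ := 1 - 1 / (2 * κ)

theorem half_le_rate (hκ : 1 ≤ κ) : 1 / 2 ≤ rate κ := by
  have : 1 / (2 * κ) ≤ 1 / 2 := one_div_le_one_div_of_le (by norm_num) (by linarith)
  rw [rate]
  linarith

theorem rate_nonneg (hκ : 1 ≤ κ) : 0 ≤ rate κ := by linarith [half_le_rate hκ]

theorem rate_le_one (hκ : 1 ≤ κ) : rate κ ≤ 1 := by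
  have : 0 ≤ 1 / (2 * κ) := by positivity
  rw [rate]
  linarith

theorem rate_pow_le_one (hκ : 1 ≤ κ) (k : ℕ) : rate κ ^ k ≤ 1 :=
  pow_le_one₀ (rate_nonneg hκ) (rate_le_one hκ)

/-- The deterministic bound `η_k = κ exp (2 l ∑_{i < k} ρ^i)` for the quality of `G_k`, where
`ρ = 1 - 1 / (2 κ)` and `l = M λ₀`; the geometric sum is written in closed form. -/
def quality (κ l : ℝ) (k : ℕ) : ℝ := κ * Real.exp (4 * κ * l * (1 - rate κ ^ k))

theorem le_quality (hκ : 1 ≤ κ) {l : ℝ} (hl : 0 ≤ l) (k : ℕ) : κ ≤ quality κ l k := by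
  have h1 : 0 ≤ 4 * κ * l * (1 - rate κ ^ k) :=
    mul_nonneg (by positivity) (sub_nonneg.2 (rate_pow_le_one hκ k))
  exact le_mul_of_one_le_right (by linarith) (Real.one_le_exp h1)

theorem quality_le (hκ : 1 ≤ κ) {l : ℝ} (hl : 0 ≤ l) (h : l ≤ Real.log (3 / 2) / (4 * κ)) (k : ℕ) :
    quality κ l k ≤ 3 / 2 * κ := by
  have h0 : 4 * κ * l ≤ Real.log (3 / 2) := by
    rw [le_div_iff₀ (by linarith)] at h
    linarith
  have h1 : 4 * κ * l * (1 - rate κ ^ k) ≤ Real.log (3 / 2) :=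
    (mul_le_of_le_one_right (by positivity) (by
      linarith [pow_nonneg (rate_nonneg hκ) k])).trans h0
  have h2 : Real.exp (4 * κ * l * (1 - rate κ ^ k)) ≤ 3 / 2 := by
    rw [← Real.exp_log (show (0 : ℝ) < 3 / 2 by norm_num)]
    exact Real.exp_le_exp.2 h1
  rw [quality, mul_comm]
  exact mul_le_mul_of_nonneg_right h2 (by linarith)

theorem quality_succ (hκ : 1 ≤ κ) (l : ℝ) (k : ℕ) :
    quality κ l (k + 1) = Real.exp (l * rate κ ^ k) ^ 2 * quality κ l k := by
  have e : 4 * κ * l * (1 - rate κ ^ (k + 1))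
      = l * rate κ ^ k + l * rate κ ^ k + 4 * κ * l * (1 - rate κ ^ k) := by
    rw [pow_succ, rate]
    field_simp
    ring
  rw [quality, quality, e, Real.exp_add, Real.exp_add]
  ring

theorem Setting.init_le (hs : Setting M μ L κ f x₀) (hκ : 1 ≤ κ) : M * lam f x₀ ≤ 1 / (8 * κ) := by
  refine hs.init.trans ?_
  have : Real.log (3 / 2) ≤ 1 / 2 :=
    (Real.log_le_sub_one_of_pos (by norm_num)).trans (by norm_num)
  rw [div_le_div_iff₀ (by linarith) (by linarith)]
  nlinarith

/-- The invariant of the linear phase: the point has converged at least linearly, and the matrix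
approximates the Hessian up to the factor `η_k`. -/
structure LinearPhase (f : Vec d → ℝ) (M κ : ℝ) (x₀ : Vec d) (k : ℕ) (x : Vec d) (G : Mat d) :
    Prop where
  lam_le : lam f x ≤ rate κ ^ k * lam f x₀
  sandwich : Sandwich (hess f x) G (quality κ (M * lam f x₀) k)

theorem linearPhase_zero (hs : Setting M μ L κ f x₀) :
    LinearPhase f M κ x₀ 0 x₀ (L • (1 : Mat d)) := by
  have hf := hs.convex_smooth
  refine ⟨by simp, isHermitian_real_smul Matrix.isHermitian_one _, fun v => ?_, fun v => ?_⟩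
  · rw [form_smul, Matrix.one_mulVec]
    exact hf.form_upper x₀ v
  · rw [form_smul, Matrix.one_mulVec]
    have h1 := hf.form_lower x₀ v
    have h2 := hf.mu_pos
    have h3 := hf.L_pos
    simp only [quality, pow_zero, sub_self, mul_zero, Real.exp_zero, mul_one, hs.cond_eq]
    calc L * (v ⬝ᵥ v) = L / μ * (μ * (v ⬝ᵥ v)) := by field_simp
      _ ≤ _ := by gcongr

theorem LinearPhase.scaled_lam_le (hs : Setting M μ L κ f x₀) {k : ℕ} {x : Vec d} {G : Mat d}
    (h : LinearPhase f M κ x₀ k x G) : M * lam f x ≤ M * lam f x₀ * rate κ ^ k := by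
  have := mul_le_mul_of_nonneg_left h.lam_le hs.self_conc.M_pos.le
  linarith

theorem LinearPhase.corr_le (hs : Setting M μ L κ f x₀) {k : ℕ} {x : Vec d} {G : Mat d}
    (h : LinearPhase f M κ x₀ k x G) : corr f M x G ≤ 1 + M * lam f x₀ * rate κ ^ k := by
  have := corr_sub_one_le hs.self_conc hs.convex_smooth h.sandwich
  have := h.scaled_lam_le hs
  linarith

theorem Setting.init_mul_rate_pow_le (hs : Setting M μ L κ f x₀) (hκ : 1 ≤ κ) (k : ℕ) :
    M * lam f x₀ * rate κ ^ k ≤ 1 / (8 * κ) :=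
  (mul_le_of_le_one_right (mul_nonneg hs.self_conc.M_pos.le (lam_nonneg f x₀))
    (rate_pow_le_one hκ k)).trans (hs.init_le hκ)

theorem LinearPhase.scaled_lam_le_eighth (hs : Setting M μ L κ f x₀) (hκ : 1 ≤ κ) {k : ℕ}
    {x : Vec d} {G : Mat d} (h : LinearPhase f M κ x₀ k x G) : M * lam f x ≤ 1 / 8 :=
  (h.scaled_lam_le hs).trans <| (hs.init_mul_rate_pow_le hκ k).trans <|
    one_div_le_one_div_of_le (by norm_num) (by linarith)

/-- The linear phase persists under every update that keeps the sandwich around the next Hessian. -/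
theorem LinearPhase.succ (hs : Setting M μ L κ f x₀) (hκ : 1 ≤ κ) {k : ℕ} {x : Vec d}
    {G G' : Mat d} (h : LinearPhase f M κ x₀ k x G)
    (hG' : ∀ η, 1 ≤ η → Sandwich (hess f (nextPoint f x G)) (corr f M x G • G) η →
      Sandwich (hess f (nextPoint f x G)) G' η) :
    LinearPhase f M κ x₀ (k + 1) (nextPoint f x G) G' := by
  have hl0 : 0 ≤ M * lam f x₀ := mul_nonneg hs.self_conc.M_pos.le (lam_nonneg f x₀)
  have hη := le_quality hκ hl0 k
  have hη' := quality_le hκ hl0 hs.init k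
  have hc1 := one_le_corr (f := f) hs.self_conc.M_pos.le x G
  have hc := h.corr_le hs
  have hlk := hs.init_mul_rate_pow_le hκ k
  have hκ0 : 0 < κ := by linarith
  have h8 : 1 / (8 * κ) ≤ 1 / 8 := one_div_le_one_div_of_le (by norm_num) (by linarith)
  refine ⟨?_, ?_⟩
  · have h1 := lam_nextPoint_le hs.self_conc hs.convex_smooth (hκ.trans hη) h.sandwich rfl
      (by linarith)
    refine h1.trans ?_
    rw [pow_succ']
    refine le_trans (mul_le_mul_of_nonneg_right (b := _) (c := rate κ) ?_ (lam_nonneg f x))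
      (by rw [mul_assoc]; exact mul_le_mul_of_nonneg_left h.lam_le (rate_nonneg hκ))
    obtain ⟨a, ha⟩ : ∃ a, a = corr f M x G - 1 := ⟨_, rfl⟩
    obtain ⟨η, hηe⟩ : ∃ η, η = quality κ (M * lam f x₀) k := ⟨_, rfl⟩
    obtain ⟨t, ht⟩ : ∃ t, t = 1 / κ := ⟨_, rfl⟩
    rw [← ha, ← hηe]
    rw [← hηe] at hη hη'
    have ht0 : 0 < t := by rw [ht]; positivity
    have ht1 : t ≤ 1 := by rw [ht, div_le_one hκ0]; exact hκ
    have ha0 : 0 ≤ a := by linarith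
    have hat : a ≤ t / 8 := by
      have : 1 / (8 * κ) = t / 8 := by rw [ht]; field_simp
      linarith
    have h2 : (η - 1 + a) / η ≤ 1 - 2 / 3 * (1 - a) * t := by
      have hη0 : 0 < η := by linarith
      have e : (η - 1 + a) / η = 1 - (1 - a) / η := by field_simp; ring
      have : (1 - a) / (3 / 2 * κ) ≤ (1 - a) / η :=
        div_le_div_of_nonneg_left (by linarith) hη0 hη'
      have e2 : (1 - a) / (3 / 2 * κ) = 2 / 3 * (1 - a) * t := by rw [ht]; field_simp
      linarith
    have e : rate κ = 1 - t / 2 := by rw [rate, ht]; field_simp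
    rw [e]
    calc (1 + a / 2) * ((η - 1 + a) / η) ≤ (1 + a / 2) * (1 - 2 / 3 * (1 - a) * t) := by gcongr
      _ ≤ (1 + t / 16) * (1 - 7 / 12 * t) := by
          have : 1 - 2 / 3 * (1 - a) * t ≤ 1 - 7 / 12 * t := by nlinarith
          exact mul_le_mul (by linarith) this (by nlinarith) (by linarith)
      _ ≤ 1 - t / 2 := by nlinarith
  · have h1 := h.sandwich.corrected hs.self_conc (by linarith)
    have hA := hs.convex_smooth.posDef (nextPoint f x G)
    refine hG' _ (hκ.trans (le_quality hκ hl0 _)) (h1.mono hA ?_)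
    rw [quality_succ hκ]
    refine mul_le_mul_of_nonneg_right ?_ (by linarith)
    refine pow_le_pow_left₀ (by linarith) (hc.trans ?_) 2
    linarith [Real.add_one_le_exp (M * lam f x₀ * rate κ ^ k)]

/-- A weight `W` turns the gap `G - ∇²f(x)` into the potential `tr (W(x) (G - ∇²f(x)))`. The two
cases of interest are `W(x) = ∇²f(x)⁻¹` for BFGS and `W(x) = I / μ` for SR1; what both have in
common is collected here. -/
structure IsWeight (f : Vec d → ℝ) (M κ : ℝ) (W : Vec d → Mat d) : Prop where
  posSemidef : ∀ x, (W x).PosSemidef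
  inv_le : ∀ x v, v ⬝ᵥ (hess f x)⁻¹ *ᵥ v ≤ v ⬝ᵥ W x *ᵥ v
  trace_le : ∀ x, (W x * hess f x).trace ≤ d * κ
  next_le : ∀ x G v, v ⬝ᵥ W (nextPoint f x G) *ᵥ v ≤ corr f M x G * (v ⬝ᵥ W x *ᵥ v)

theorem isWeight_inv_hess (hs : Setting M μ L κ f x₀) (hκ : 1 ≤ κ) :
    IsWeight f M κ fun x => (hess f x)⁻¹ where
  posSemidef x := (hs.convex_smooth.posDef x).inv.posSemidef
  inv_le _ _ := le_rfl
  trace_le x := by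
    rw [trace_inv_mul_self (hs.convex_smooth.posDef x), Fintype.card_fin]
    exact le_mul_of_one_le_right (Nat.cast_nonneg d) hκ
  next_le x G v :=
    form_inv_le (hs.convex_smooth.posDef x) (hs.convex_smooth.posDef _)
      (by linarith [one_le_corr (f := f) hs.self_conc.M_pos.le x G]) (hess_le_next hs.self_conc x G) v

theorem form_inv_le_of_lower {A : Mat d} (hA : A.PosDef) (hμ : 0 < μ)
    (h : ∀ v : Fin d → ℝ, μ * (v ⬝ᵥ v) ≤ v ⬝ᵥ A *ᵥ v) (v : Fin d → ℝ) :
    v ⬝ᵥ A⁻¹ *ᵥ v ≤ μ⁻¹ * (v ⬝ᵥ v) := by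
  have := form_inv_le (Matrix.PosDef.one (n := Fin d) (R := ℝ)) hA (inv_pos.2 hμ) (fun v => by
    rw [Matrix.one_mulVec, le_inv_mul_iff₀ hμ]
    exact h v) v
  rwa [inv_one, Matrix.one_mulVec] at this

theorem diag_eq_form (A : Mat d) (i : Fin d) : A i i = Pi.single i 1 ⬝ᵥ A *ᵥ Pi.single i 1 := by
  simp

theorem isWeight_smul_one (hs : Setting M μ L κ f x₀) :
    IsWeight f M κ fun _ => μ⁻¹ • (1 : Mat d) where
  posSemidef _ := Matrix.PosSemidef.one.smul (inv_nonneg.2 hs.convex_smooth.mu_pos.le)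
  inv_le x v := by
    rw [form_smul, Matrix.one_mulVec]
    exact form_inv_le_of_lower (hs.convex_smooth.posDef x) hs.convex_smooth.mu_pos
      (hs.convex_smooth.form_lower x) v
  trace_le x := by
    have hμ := hs.convex_smooth.mu_pos
    have h1 : (hess f x).trace ≤ d * L := by
      calc (hess f x).trace ≤ ∑ _i : Fin d, L := Finset.sum_le_sum fun i _ => by
            have := hs.convex_smooth.form_upper x (Pi.single i 1)
            rw [← diag_eq_form] at this
            simpa using this
        _ = d * L := by simp
    rw [Matrix.smul_mul, one_mul, Matrix.trace_smul, smul_eq_mul, hs.cond_eq, inv_mul_le_iff₀ hμ]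
    refine h1.trans (le_of_eq ?_)
    field_simp
  next_le x G v := by
    have h1 : 0 ≤ v ⬝ᵥ (μ⁻¹ • (1 : Mat d)) *ᵥ v :=
      form_nonneg (Matrix.PosSemidef.one.smul (inv_nonneg.2 hs.convex_smooth.mu_pos.le)) v
    exact le_mul_of_one_le_left h1 (one_le_corr hs.self_conc.M_pos.le x G)

theorem trace_mul_le_trace_mul {n : Type*} [Fintype n] [DecidableEq n] {W R R' : Matrix n n ℝ}
    (hW : W.PosSemidef) (hR : R.IsHermitian) (hR' : R'.IsHermitian)
    (h : ∀ v, v ⬝ᵥ R *ᵥ v ≤ v ⬝ᵥ R' *ᵥ v) : (W * R).trace ≤ (W * R').trace := by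
  have := trace_mul_nonneg hW (posSemidef_of_form_nonneg (hR'.sub hR) fun v => by
    rw [Matrix.sub_mulVec, dotProduct_sub, sub_nonneg]
    exact h v)
  rwa [mul_sub, Matrix.trace_sub, sub_nonneg] at this

section Weight

variable {W : Vec d → Mat d}

/-- The potential controls the quality of the approximation. -/
theorem IsWeight.sandwich (hW : IsWeight f M κ W) (hf : StronglyConvexSmooth μ L f) {x : Vec d}
    {G : Mat d} {η : ℝ} (h : Sandwich (hess f x) G η) :
    Sandwich (hess f x) G (1 + (W x * (G - hess f x)).trace) := by
  have hH := hf.posDef x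
  have hR := h.posSemidef_sub hH
  refine ⟨h.symm, h.lower, fun v => ?_⟩
  have h1 := form_le_trace_mul_form hH hR v
  have h2 : ((hess f x)⁻¹ * (G - hess f x)).trace ≤ (W x * (G - hess f x)).trace := by
    rw [Matrix.trace_mul_comm, Matrix.trace_mul_comm (W x)]
    exact trace_mul_le_trace_mul hR hH.inv.isHermitian (hW.posSemidef x).isHermitian (hW.inv_le x)
  have h3 := mul_le_mul_of_nonneg_right h2 (form_nonneg hH.posSemidef v)
  rw [Matrix.sub_mulVec, dotProduct_sub] at h1
  linarith

theorem IsWeight.potential_nonneg (hW : IsWeight f M κ W) (hf : StronglyConvexSmooth μ L f)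
    {x : Vec d} {G : Mat d} {η : ℝ} (h : Sandwich (hess f x) G η) :
    0 ≤ (W x * (G - hess f x)).trace :=
  trace_mul_nonneg (hW.posSemidef x) (h.posSemidef_sub (hf.posDef x))

theorem IsWeight.potential_le (hW : IsWeight f M κ W) (hf : StronglyConvexSmooth μ L f)
    {x : Vec d} {G : Mat d} {η : ℝ} (hη : 1 ≤ η) (h : Sandwich (hess f x) G η) :
    (W x * (G - hess f x)).trace ≤ (η - 1) * (d * κ) := by
  have hH := (hf.posDef x).isHermitian
  have h1 := trace_mul_le_trace_mul (hW.posSemidef x) (h.symm.sub hH)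
    (isHermitian_real_smul hH (η - 1)) (fun v => by
      rw [form_smul, Matrix.sub_mulVec, dotProduct_sub]
      linarith [h.upper v])
  rw [Matrix.mul_smul, Matrix.trace_smul, smul_eq_mul] at h1
  exact h1.trans (mul_le_mul_of_nonneg_left (hW.trace_le x) (by linarith))

/-- The growth of the potential when the point moves and the matrix is corrected. -/
theorem IsWeight.potential_corrected_le (hW : IsWeight f M κ W)
    (hsc : StronglySelfConcordant M f) (hf : StronglyConvexSmooth μ L f)
    {x : Vec d} {G : Mat d} {η : ℝ} (hη : 0 ≤ η) (h : Sandwich (hess f x) G η) :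
    (W (nextPoint f x G) * (corr f M x G • G - hess f (nextPoint f x G))).trace ≤
      corr f M x G ^ 2 * (W x * (G - hess f x)).trace + (corr f M x G ^ 2 - 1) * (d * κ) := by
  have hc := one_le_corr (f := f) hsc.M_pos.le x G
  have hmove := hess_le_next hsc x G
  have hwt := hW.next_le x G
  have hA := hf.posDef (nextPoint f x G)
  have hR := (h.corrected hsc hη).posSemidef_sub hA
  obtain ⟨c, hcdef⟩ : ∃ c, c = corr f M x G := ⟨_, rfl⟩
  obtain ⟨y, hy⟩ : ∃ y, y = nextPoint f x G := ⟨_, rfl⟩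
  simp only [← hcdef, ← hy] at *
  have hc0 : 0 < c := by linarith
  have hH := (hf.posDef x).isHermitian
  have h1 : (W y * (c • G - hess f y)).trace ≤ c * (W x * (c • G - hess f y)).trace := by
    have e : c * ((c • G - hess f y) * W x).trace = ((c • G - hess f y) * (c • W x)).trace := by
      rw [Matrix.mul_smul, Matrix.trace_smul, smul_eq_mul]
    rw [Matrix.trace_mul_comm, Matrix.trace_mul_comm (W x), e]
    exact trace_mul_le_trace_mul hR (hW.posSemidef y).isHermitian
      (isHermitian_real_smul (hW.posSemidef x).isHermitian c) fun v => by
        rw [form_smul]; exact hwt v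
  have h2 : (W x * (c • G - hess f y)).trace ≤ (W x * (c • G - c⁻¹ • hess f x)).trace := by
    refine trace_mul_le_trace_mul (hW.posSemidef x) hR.isHermitian
      ((isHermitian_real_smul h.symm c).sub (isHermitian_real_smul hH _)) fun v => ?_
    rw [Matrix.sub_mulVec, dotProduct_sub, Matrix.sub_mulVec, dotProduct_sub, form_smul _ c⁻¹]
    have := (inv_mul_le_iff₀ hc0).2 (hmove v)
    linarith
  have h3 : c * (W x * (c • G - c⁻¹ • hess f x)).trace =
      c ^ 2 * (W x * (G - hess f x)).trace + (c ^ 2 - 1) * (W x * hess f x).trace := by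
    simp only [mul_sub, Matrix.mul_smul, Matrix.trace_sub, Matrix.trace_smul, smul_eq_mul]
    field_simp
    ring
  have h4 : (c ^ 2 - 1) * (W x * hess f x).trace ≤ (c ^ 2 - 1) * (d * κ) :=
    mul_le_mul_of_nonneg_left (hW.trace_le x) (by nlinarith)
  linarith [mul_le_mul_of_nonneg_left h2 hc0.le]

/-- The Lyapunov function `θ = tr (W (G - ∇²f)) + 3 d κ M λ_f`. The second summand absorbs the
growth of the potential that the correction of `G` causes; that growth is about `2 d κ M λ_f`, and
the constant `3` leaves room for the terms of higher order when `M λ_f ≤ 1 / 8`. -/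
def lyapunov (f : Vec d → ℝ) (M κ : ℝ) (W : Vec d → Mat d) (x : Vec d) (G : Mat d) : ℝ :=
  (W x * (G - hess f x)).trace + 3 * (d * κ) * (M * lam f x)

theorem LinearPhase.lyapunov_nonneg (hs : Setting M μ L κ f x₀) (hκ : 1 ≤ κ)
    (hW : IsWeight f M κ W) {k : ℕ} {x : Vec d} {G : Mat d} (h : LinearPhase f M κ x₀ k x G) :
    0 ≤ lyapunov f M κ W x G := by
  have h1 := hW.potential_nonneg hs.convex_smooth h.sandwich
  have h2 := mul_nonneg hs.self_conc.M_pos.le (lam_nonneg f x)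
  have : 0 ≤ 3 * (d * κ) * (M * lam f x) := by positivity
  exact add_nonneg h1 this

theorem LinearPhase.lyapunov_le (hs : Setting M μ L κ f x₀) (hκ : 1 ≤ κ)
    (hW : IsWeight f M κ W) {k : ℕ} {x : Vec d} {G : Mat d} (h : LinearPhase f M κ x₀ k x G) :
    lyapunov f M κ W x G ≤ 3 / 2 * (d * κ ^ 2) := by
  have hl0 : 0 ≤ M * lam f x₀ := mul_nonneg hs.self_conc.M_pos.le (lam_nonneg f x₀)
  have hη := le_quality hκ hl0 k
  have hη' := quality_le hκ hl0 hs.init k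
  have h1 := hW.potential_le hs.convex_smooth (hκ.trans hη) h.sandwich
  have h2 := h.scaled_lam_le_eighth hs hκ
  have hD : 0 ≤ d * κ := by positivity
  rw [lyapunov]
  nlinarith [mul_le_mul_of_nonneg_right hη' hD, mul_le_mul_of_nonneg_left h2 hD]

/-- The step estimate with `η = 1 + σ`, where `σ` is the potential: the contraction of `λ` is governed
by `σ + M λ`, hence by the Lyapunov function. The factor `17 / 16` is `1 + M λ / 2` at
`M λ = 1 / 8`. -/
theorem LinearPhase.lam_nextPoint_le_lyapunov (hs : Setting M μ L κ f x₀) (hκ : 1 ≤ κ) (hd : 1 ≤ d)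
    (hW : IsWeight f M κ W) {k : ℕ} {x : Vec d} {G : Mat d} (h : LinearPhase f M κ x₀ k x G) :
    lam f (nextPoint f x G) ≤ (1 + M * lam f x / 2) *
      ((W x * (G - hess f x)).trace + M * lam f x) * lam f x ∧
    lam f (nextPoint f x G) ≤ 17 / 16 * lyapunov f M κ W x G * lam f x := by
  have hσ := hW.potential_nonneg hs.convex_smooth h.sandwich
  have hsw := hW.sandwich hs.convex_smooth h.sandwich
  have ha := corr_sub_one_le hs.self_conc hs.convex_smooth h.sandwich
  have hl := h.scaled_lam_le_eighth hs hκ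
  have hc1 := one_le_corr (f := f) hs.self_conc.M_pos.le x G
  have hl0 := mul_nonneg hs.self_conc.M_pos.le (lam_nonneg f x)
  have h1 := lam_nextPoint_le hs.self_conc hs.convex_smooth (by linarith) hsw rfl (by linarith)
  have hd' : (1 : ℝ) ≤ d := by exact_mod_cast hd
  have hD : 1 ≤ d * κ := by nlinarith
  rw [lyapunov]
  obtain ⟨σ, hσdef⟩ : ∃ σ, σ = (W x * (G - hess f x)).trace := ⟨_, rfl⟩
  obtain ⟨l, hldef⟩ : ∃ l, l = M * lam f x := ⟨_, rfl⟩
  obtain ⟨a, hadef⟩ : ∃ a, a = corr f M x G - 1 := ⟨_, rfl⟩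
  rw [← hσdef, ← hadef] at h1
  rw [← hσdef] at hσ
  rw [← hσdef, ← hldef]
  rw [← hldef] at hl hl0 ha
  rw [← hadef] at ha
  have ha0 : 0 ≤ a := by linarith
  have hq : (1 + σ - 1 + a) / (1 + σ) ≤ σ + l := by
    rw [div_le_iff₀ (by linarith)]
    nlinarith
  have hfst : lam f (nextPoint f x G) ≤ (1 + l / 2) * (σ + l) * lam f x := by
    refine h1.trans (mul_le_mul_of_nonneg_right ?_ (lam_nonneg f x))
    exact mul_le_mul (by linarith) hq (div_nonneg (by linarith) (by linarith)) (by linarith)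
  refine ⟨hfst, hfst.trans (mul_le_mul_of_nonneg_right ?_ (lam_nonneg f x))⟩
  exact mul_le_mul (by linarith) (by nlinarith) (by linarith) (by norm_num)

/-- The contraction of the Lyapunov function by a step that removes the fraction `1 / d` of the
corrected potential. -/
theorem LinearPhase.contraction (hs : Setting M μ L κ f x₀) (hκ : 1 ≤ κ) (hd : 2 ≤ d)
    (hW : IsWeight f M κ W) {k : ℕ} {x : Vec d} {G : Mat d} (h : LinearPhase f M κ x₀ k x G) :
    (1 - 1 / d) * (W (nextPoint f x G) * (corr f M x G • G - hess f (nextPoint f x G))).trace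
      + 3 * (d * κ) * (M * lam f (nextPoint f x G)) ≤
    (1 - 1 / d) * (1 + 9 * (d * κ) * (M * lam f x₀ * rate κ ^ k)) * lyapunov f M κ W x G := by
  have hl0 : 0 ≤ M * lam f x₀ := mul_nonneg hs.self_conc.M_pos.le (lam_nonneg f x₀)
  have hη := hκ.trans (le_quality hκ hl0 k)
  have hσ := hW.potential_nonneg hs.convex_smooth h.sandwich
  have hpc := hW.potential_corrected_le hs.self_conc hs.convex_smooth (by linarith) h.sandwich
  have hlam := (h.lam_nextPoint_le_lyapunov hs hκ (by omega) hW).1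
  have hθ := h.lyapunov_nonneg hs hκ hW
  have ha := corr_sub_one_le hs.self_conc hs.convex_smooth h.sandwich
  have hl := h.scaled_lam_le_eighth hs hκ
  have hlk := h.scaled_lam_le hs
  have hc1 := one_le_corr (f := f) hs.self_conc.M_pos.le x G
  have hl0' := mul_nonneg hs.self_conc.M_pos.le (lam_nonneg f x)
  have hd' : (2 : ℝ) ≤ d := by exact_mod_cast hd
  have hD : 1 ≤ d * κ := by nlinarith
  have hq : 1 / 2 ≤ 1 - 1 / (d : ℝ) := by
    have : 1 / (d : ℝ) ≤ 1 / 2 := one_div_le_one_div_of_le (by norm_num) hd'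
    linarith
  have hl'0 := mul_nonneg hs.self_conc.M_pos.le (lam_nonneg f (nextPoint f x G))
  have hMl := mul_le_mul_of_nonneg_left hlam hs.self_conc.M_pos.le
  have e : M * ((1 + M * lam f x / 2) * ((W x * (G - hess f x)).trace + M * lam f x) * lam f x)
    = (1 + M * lam f x / 2) * ((W x * (G - hess f x)).trace + M * lam f x) * (M * lam f x) := by
    ring
  rw [e] at hMl
  have hthdef : lyapunov f M κ W x G
    = (W x * (G - hess f x)).trace + 3 * (d * κ) * (M * lam f x) := rfl
  generalize (W x * (G - hess f x)).trace = σ at *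
  generalize M * lam f x = l at *
  generalize corr f M x G = c at *
  generalize M * lam f (nextPoint f x G) = l' at *
  generalize (W (nextPoint f x G) * (c • G - hess f (nextPoint f x G))).trace = σ' at *
  generalize (d : ℝ) * κ = D at *
  generalize M * lam f x₀ * rate κ ^ k = m at *
  generalize lyapunov f M κ W x G = θ at *
  generalize 1 - 1 / (d : ℝ) = q at *
  -- Since `q ≥ 1/2`, the new value of `3 D M λ` counts at most twice inside the factor `q`.
  have hc2 : c ^ 2 ≤ 1 + 17 / 8 * l := by nlinarith
  have h1 : σ' ≤ (1 + 17 / 8 * l) * σ + 17 / 8 * l * D := by nlinarith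
  have h2 : 2 * l' ≤ 17 / 8 * (σ + l) * l := by
    have : (1 + l / 2) * (σ + l) * l ≤ 17 / 16 * (σ + l) * l := by
      have : 0 ≤ (σ + l) * l := by positivity
      nlinarith
    linarith
  have h3 : σ' + 3 * D * (2 * l') ≤ (1 + 9 * D * l) * θ := by
    have hσl : 0 ≤ σ * l := by positivity
    have hDl : 0 ≤ D * l := by positivity
    have h5 : 3 * D * (2 * l') ≤ 3 * D * (17 / 8 * (σ + l) * l) := by gcongr
    rw [hthdef]
    nlinarith [mul_nonneg (sub_nonneg.2 hD) hσl, mul_nonneg hDl (sub_nonneg.2 hl),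
      mul_nonneg hDl hDl, mul_nonneg hDl hσ]
  have h4 : (1 + 9 * D * l) * θ ≤ (1 + 9 * D * m) * θ := by
    have : D * l ≤ D * m := by gcongr
    exact mul_le_mul_of_nonneg_right (by linarith) hθ
  have hl'' : 3 * D * l' ≤ q * (3 * D * (2 * l')) := by
    have : 0 ≤ 3 * D * l' := by positivity
    nlinarith
  calc q * σ' + 3 * D * l' ≤ q * (σ' + 3 * D * (2 * l')) := by linarith
    _ ≤ q * ((1 + 9 * D * m) * θ) := mul_le_mul_of_nonneg_left (h3.trans h4) (by linarith)
    _ = _ := by ring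

end Weight

end

/-! ### From the Lyapunov function to superlinear convergence -/

section

variable {d : ℕ} {f : Vec d → ℝ} {M μ L κ : ℝ} {x₀ : Vec d}

/-- The length of the first part of the burn-in. Afterwards the linear rate has brought `M λ_k` down
so far that `∑ d κ M λ_k` is bounded by a constant. -/
def firstStage (d : ℕ) (κ : ℝ) : ℕ := ⌈2 * κ * Real.log (3 * (d * κ))⌉₊

/-- The length of the second part of the burn-in. The Lyapunov function starts it below `O(d κ²)` and
has to fall below a constant; the other factor `d² / δ` pays for the union bound over all later
times, and `δ = 1` serves the greedy methods. -/
def secondStage (d : ℕ) (κ δ : ℝ) : ℕ := ⌈d * Real.log (12 * (d ^ 3 * κ ^ 2 / δ))⌉₊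

theorem burnIn_le (hd : 2 ≤ d) (hκ : 1 ≤ κ) {δ : ℝ} (hδ : 0 < δ) (hδ1 : δ ≤ 1) :
    ((firstStage d κ + secondStage d κ δ : ℕ) : ℝ) ≤ 8 * ((d + κ) * Real.log (d * κ / δ)) := by
  have hd' : (2 : ℝ) ≤ d := by exact_mod_cast hd
  obtain ⟨X, hX⟩ : ∃ X, X = d * κ / δ := ⟨_, rfl⟩
  have hDX : d * κ ≤ X := by
    rw [hX, le_div_iff₀ hδ]
    exact mul_le_of_le_one_right (by positivity) hδ1
  have hX2 : 2 ≤ X := by nlinarith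
  have hlX : 0.69 ≤ Real.log X :=
    (by linarith [Real.log_two_gt_d9] : (0.69 : ℝ) ≤ Real.log 2).trans
      (Real.log_le_log (by norm_num) hX2)
  have h1 : Real.log (3 * (d * κ)) ≤ 3 * Real.log X := by
    have e : 3 * Real.log X = Real.log (X ^ 3) := by rw [Real.log_pow]; norm_num
    rw [e]
    refine Real.log_le_log (by positivity) ?_
    have : (3 : ℝ) ≤ X ^ 2 := by nlinarith
    calc 3 * (d * κ) ≤ X ^ 2 * X := mul_le_mul this hDX (by positivity) (by positivity)
      _ = X ^ 3 := by ring
  have h2 : Real.log (12 * (d ^ 3 * κ ^ 2 / δ)) ≤ 7 * Real.log X := by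
    have e : 7 * Real.log X = Real.log (X ^ 7) := by rw [Real.log_pow]; norm_num
    rw [e]
    refine Real.log_le_log (by positivity) ?_
    have h12 : (12 : ℝ) ≤ X ^ 4 := by
      calc (12 : ℝ) ≤ 2 ^ 4 := by norm_num
        _ ≤ X ^ 4 := by gcongr
    have h3 : d ^ 3 * κ ^ 2 / δ ≤ X ^ 3 := by
      rw [hX, div_pow, mul_pow]
      have a1 : κ ^ 2 ≤ κ ^ 3 := pow_le_pow_right₀ hκ (by norm_num)
      have a2 : δ ^ 3 ≤ δ := by simpa using pow_le_pow_of_le_one hδ.le hδ1 (show 1 ≤ 3 by norm_num)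
      gcongr
    calc 12 * (d ^ 3 * κ ^ 2 / δ) ≤ X ^ 4 * X ^ 3 :=
          mul_le_mul h12 h3 (by positivity) (by positivity)
      _ = X ^ 7 := by ring
  have hl1 : 0 ≤ Real.log (3 * (d * κ)) := Real.log_nonneg (by nlinarith)
  have hl2 : 0 ≤ Real.log (12 * (d ^ 3 * κ ^ 2 / δ)) := by
    apply Real.log_nonneg
    have : (1 : ℝ) ≤ d ^ 3 * κ ^ 2 / δ := by
      rw [le_div_iff₀ hδ, one_mul]
      exact hδ1.trans (one_le_mul_of_one_le_of_one_le (one_le_pow₀ (by linarith)) (one_le_pow₀ hκ))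
    linarith
  have c1 : (firstStage d κ : ℝ) ≤ 2 * κ * Real.log (3 * (d * κ)) + 1 :=
    (Nat.ceil_lt_add_one (by positivity)).le
  have c2 : (secondStage d κ δ : ℝ) ≤ d * Real.log (12 * (d ^ 3 * κ ^ 2 / δ)) + 1 :=
    (Nat.ceil_lt_add_one (by positivity)).le
  rw [← hX]
  push_cast
  nlinarith [mul_le_mul_of_nonneg_left h1 (by linarith : 0 ≤ 2 * κ),
    mul_le_mul_of_nonneg_left h2 (by linarith : (0 : ℝ) ≤ d),
    mul_le_mul (by linarith : 3 ≤ d + κ) hlX (by norm_num) (by linarith)]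

theorem one_sub_pow_ceil_le {t Y : ℝ} (ht : 0 < t) (ht1 : t ≤ 1) (hY : 0 < Y) :
    (1 - t) ^ ⌈t⁻¹ * Real.log Y⌉₊ ≤ Y⁻¹ := by
  calc (1 - t) ^ ⌈t⁻¹ * Real.log Y⌉₊ ≤ Real.exp (-t) ^ ⌈t⁻¹ * Real.log Y⌉₊ :=
        pow_le_pow_left₀ (by linarith) (Real.one_sub_le_exp_neg t) _
    _ = Real.exp (-(t * ⌈t⁻¹ * Real.log Y⌉₊)) := by
        rw [← Real.exp_nat_mul]; congr 1; ring
    _ ≤ Real.exp (-Real.log Y) := by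
        apply Real.exp_le_exp.2
        have := Nat.le_ceil (t⁻¹ * Real.log Y)
        rw [inv_mul_le_iff₀ ht] at this
        linarith
    _ = Y⁻¹ := by rw [Real.exp_neg, Real.exp_log hY]

theorem rate_pow_firstStage_le (hd : 1 ≤ d) (hκ : 1 ≤ κ) :
    rate κ ^ firstStage d κ ≤ (3 * (d * κ))⁻¹ := by
  have hd' : (1 : ℝ) ≤ d := by exact_mod_cast hd
  have := one_sub_pow_ceil_le (t := 1 / (2 * κ)) (Y := 3 * (d * κ)) (by positivity)
    (by rw [div_le_one (by linarith)]; linarith) (by positivity)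
  simpa [rate, firstStage] using this

theorem one_sub_inv_pow_secondStage_le (hd : 1 ≤ d) (hκ : 1 ≤ κ) {δ : ℝ} (hδ : 0 < δ) :
    (1 - 1 / d : ℝ) ^ secondStage d κ δ ≤ (12 * (d ^ 3 * κ ^ 2 / δ))⁻¹ := by
  have hd' : (1 : ℝ) ≤ d := by exact_mod_cast hd
  have := one_sub_pow_ceil_le (t := 1 / (d : ℝ)) (Y := 12 * (d ^ 3 * κ ^ 2 / δ)) (by positivity)
    (by rw [div_le_one (by linarith)]; linarith) (by positivity)
  rwa [one_div, inv_inv, ← one_div] at this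

/-- The contraction factor of the Lyapunov function at step `k`, with `l = M λ₀`. -/
def contractionFactor (d : ℕ) (κ l : ℝ) (k : ℕ) : ℝ :=
  (1 - 1 / d) * (1 + 9 * (d * κ) * (l * rate κ ^ k))

theorem one_sub_one_div_nonneg {d : ℕ} (hd : 1 ≤ d) : 0 ≤ 1 - 1 / (d : ℝ) := by
  have hd' : (1 : ℝ) ≤ d := by exact_mod_cast hd
  rw [sub_nonneg, div_le_one (by linarith)]
  exact hd'

theorem contractionFactor_nonneg (hd : 1 ≤ d) (hκ : 1 ≤ κ) {l : ℝ} (hl : 0 ≤ l) (k : ℕ) :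
    0 ≤ contractionFactor d κ l k := by
  have := rate_nonneg hκ
  exact mul_nonneg (one_sub_one_div_nonneg hd) (by positivity)

/-- After the first stage the contraction factors lose at most a constant against `1 - 1 / d`:
the excess is at most `exp (9 d κ l ρ^K ∑ ρ^i)`, and `∑ ρ^i ≤ 2 κ`. -/
theorem prod_contractionFactor_le (hd : 1 ≤ d) (hκ : 1 ≤ κ) {l : ℝ} (hl : 0 ≤ l)
    (hl' : l ≤ 1 / (8 * κ)) (j : ℕ) :
    ∏ i ∈ Finset.range j, contractionFactor d κ l (firstStage d κ + i) ≤
      3 * (1 - 1 / d) ^ j := by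
  have hd' : (1 : ℝ) ≤ d := by exact_mod_cast hd
  have hρ := rate_nonneg hκ
  simp only [contractionFactor]
  rw [Finset.prod_mul_distrib, Finset.prod_const, Finset.card_range, mul_comm]
  refine mul_le_mul_of_nonneg_right ?_ (pow_nonneg (one_sub_one_div_nonneg hd) j)
  have hsum : ∑ i ∈ Finset.range j, rate κ ^ i ≤ 2 * κ := by
    have h1 : rate κ < 1 := by
      have : 0 < 1 / (2 * κ) := by positivity
      rw [rate]; linarith
    have := (summable_geometric_of_lt_one hρ h1).sum_le_tsum (Finset.range j)
      (fun i _ => pow_nonneg hρ i)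
    rw [tsum_geometric_of_lt_one hρ h1, rate, sub_sub_cancel] at this
    simpa [rate] using this
  calc ∏ i ∈ Finset.range j, (1 + 9 * (d * κ) * (l * rate κ ^ (firstStage d κ + i)))
      ≤ ∏ i ∈ Finset.range j, Real.exp (9 * (d * κ) * (l * rate κ ^ (firstStage d κ + i))) := by
        refine Finset.prod_le_prod (fun i _ => by positivity) fun i _ => ?_
        linarith [Real.add_one_le_exp (9 * (d * κ) * (l * rate κ ^ (firstStage d κ + i)))]
    _ = Real.exp (9 * (d * κ) * l * rate κ ^ firstStage d κ * ∑ i ∈ Finset.range j, rate κ ^ i) := by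
        rw [← Real.exp_sum, Finset.mul_sum]
        congr 1
        exact Finset.sum_congr rfl fun i _ => by rw [pow_add]; ring
    _ ≤ Real.exp 1 := by
        apply Real.exp_le_exp.2
        calc 9 * (d * κ) * l * rate κ ^ firstStage d κ * ∑ i ∈ Finset.range j, rate κ ^ i
            ≤ 9 * (d * κ) * (1 / (8 * κ)) * (3 * (d * κ))⁻¹ * (2 * κ) := by
              have := rate_pow_firstStage_le hd hκ
              have := Finset.sum_nonneg fun i (_ : i ∈ Finset.range j) => pow_nonneg hρ i
              gcongr
          _ = 3 / 4 := by field_simp; norm_num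
          _ ≤ 1 := by norm_num
    _ ≤ 3 := by linarith [Real.exp_one_lt_d9]

open scoped ENNReal in
/-- Geometric decay after the first stage. The extended nonnegative reals serve the expectation of
the Lyapunov function as well as its value along a single trajectory. -/
theorem geometric_decay (hd : 1 ≤ d) (hκ : 1 ≤ κ) {l B : ℝ} (hl : 0 ≤ l)
    (hl' : l ≤ 1 / (8 * κ)) (hB : 0 ≤ B) {T : ℕ → ℝ≥0∞} (h0 : ∀ k, T k ≤ ENNReal.ofReal B)
    (hT : ∀ k, T (k + 1) ≤ ENNReal.ofReal (contractionFactor d κ l k) * T k) (j : ℕ) :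
    T (firstStage d κ + j) ≤ ENNReal.ofReal (3 * (1 - 1 / d) ^ j * B) := by
  have key : T (firstStage d κ + j) ≤ ENNReal.ofReal
      ((∏ i ∈ Finset.range j, contractionFactor d κ l (firstStage d κ + i)) * B) := by
    induction j with
    | zero => simpa using h0 _
    | succ j ih =>
      refine (hT (firstStage d κ + j)).trans ?_
      rw [Finset.prod_range_succ, mul_comm _ (contractionFactor d κ l (firstStage d κ + j)),
        mul_assoc, ENNReal.ofReal_mul (contractionFactor_nonneg hd hκ hl _)]
      gcongr
  exact key.trans (ENNReal.ofReal_le_ofReal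
    (mul_le_mul_of_nonneg_right (prod_contractionFactor_le hd hκ hl hl' j) hB))

/-- A geometrically decaying Lyapunov function turns into superlinear convergence. -/
theorem superlinearFrom_of_lyapunov_le (hs : Setting M μ L κ f x₀) (hκ : 1 ≤ κ) (hd : 1 ≤ d)
    {W : Vec d → Mat d} (hW : IsWeight f M κ W) {x : ℕ → Vec d} {G : ℕ → Mat d} (hx0 : x 0 = x₀)
    (hx : ∀ k, x (k + 1) = nextPoint f (x k) (G k))
    (h : ∀ k, LinearPhase f M κ x₀ k (x k) (G k)) {q : ℝ} (hq : 0 ≤ q) {k₀ : ℕ}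
    (hθ : ∀ i, lyapunov f M κ W (x (k₀ + i)) (G (k₀ + i)) ≤ 2 / 5 * q ^ i) :
    SuperlinearFrom f q κ k₀ x := by
  intro k
  induction k with
  | zero => simpa [hx0, rate] using (h k₀).lam_le
  | succ k ih =>
    have h1 := ((h (k₀ + k)).lam_nextPoint_le_lyapunov hs hκ hd hW).2
    rw [← hx] at h1
    have h2 : 17 / 16 * lyapunov f M κ W (x (k₀ + k)) (G (k₀ + k)) ≤ 1 / 2 * q ^ k := by
      have : 0 ≤ q ^ k := by positivity
      linarith [hθ k]
    rw [Nat.triangle_succ, pow_add, pow_succ]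
    calc lam f (x (k₀ + (k + 1))) ≤ 1 / 2 * q ^ k * lam f (x (k₀ + k)) :=
          h1.trans (mul_le_mul_of_nonneg_right h2 (lam_nonneg _ _))
      _ ≤ 1 / 2 * q ^ k * (q ^ (k * (k - 1) / 2) * (1 / 2) ^ k * (1 - 1 / (2 * κ)) ^ k₀ *
            lam f (x 0)) := mul_le_mul_of_nonneg_left ih (by positivity)
      _ = _ := by ring

/-- Superlinear convergence of every trajectory whose updates remove the fraction `1 / d` of the
corrected potential. -/
theorem superlinearFrom_of_potential_le (hs : Setting M μ L κ f x₀) (hκ : 1 ≤ κ) (hd : 2 ≤ d)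
    {W : Vec d → Mat d} (hW : IsWeight f M κ W) {x : ℕ → Vec d} {G : ℕ → Mat d} (hx0 : x 0 = x₀)
    (hx : ∀ k, x (k + 1) = nextPoint f (x k) (G k))
    (h : ∀ k, LinearPhase f M κ x₀ k (x k) (G k))
    (hdec : ∀ k, (W (x (k + 1)) * (G (k + 1) - hess f (x (k + 1)))).trace ≤ (1 - 1 / d) *
      (W (x (k + 1)) * (corr f M (x k) (G k) • G k - hess f (x (k + 1)))).trace) :
    SuperlinearFrom f (1 - 1 / d) κ (firstStage d κ + secondStage d κ 1) x := by
  have hd1 : 1 ≤ d := by omega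
  have hd' : (1 : ℝ) ≤ d := by exact_mod_cast hd1
  have hl0 : 0 ≤ M * lam f x₀ := mul_nonneg hs.self_conc.M_pos.le (lam_nonneg f x₀)
  have hB : 0 ≤ 3 / 2 * (d * κ ^ 2) := by positivity
  have hq := one_sub_one_div_nonneg hd1
  refine superlinearFrom_of_lyapunov_le hs hκ hd1 hW hx0 hx h hq fun i => ?_
  have hT := geometric_decay hd1 hκ hl0 (hs.init_le hκ) hB
    (T := fun k => ENNReal.ofReal (lyapunov f M κ W (x k) (G k)))
    (fun k => ENNReal.ofReal_le_ofReal ((h k).lyapunov_le hs hκ hW))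
    (fun k => by
      rw [← ENNReal.ofReal_mul (contractionFactor_nonneg hd1 hκ hl0 k)]
      apply ENNReal.ofReal_le_ofReal
      refine le_trans ?_ ((h k).contraction hs hκ hd hW)
      rw [← hx, lyapunov]
      linarith [hdec k])
    (secondStage d κ 1 + i)
  rw [← add_assoc] at hT
  have hT' := (ENNReal.ofReal_le_ofReal_iff (by positivity)).1 hT
  refine hT'.trans ?_
  have h2 := one_sub_inv_pow_secondStage_le hd1 hκ one_pos
  have hqi : 0 ≤ (1 - 1 / (d : ℝ)) ^ i := by positivity
  calc 3 * (1 - 1 / (d : ℝ)) ^ (secondStage d κ 1 + i) * (3 / 2 * (d * κ ^ 2))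
      = 9 / 2 * (d * κ ^ 2) * (1 - 1 / (d : ℝ)) ^ secondStage d κ 1 * (1 - 1 / (d : ℝ)) ^ i := by
        rw [pow_add]; ring
    _ ≤ 9 / 2 * (d * κ ^ 2) * (12 * (d ^ 3 * κ ^ 2 / 1))⁻¹ * (1 - 1 / (d : ℝ)) ^ i := by gcongr
    _ = 3 / 8 * (1 / d ^ 2) * (1 - 1 / (d : ℝ)) ^ i := by field_simp; ring
    _ ≤ 2 / 5 * (1 - 1 / (d : ℝ)) ^ i := by
        refine mul_le_mul_of_nonneg_right ?_ hqi
        have : 1 / (d : ℝ) ^ 2 ≤ 1 := by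
          rw [div_le_one (by positivity)]; exact one_le_pow₀ hd'
        linarith

end

/-! ### Second moments of the uniform distribution on the sphere -/

section

open scoped Pointwise
open MeasureTheory

variable {d : ℕ}

/-- The action of a linear isometry of `ℝ^d` on the unit sphere. -/
def sphereMap (e : Vec d ≃ₗᵢ[ℝ] Vec d) (u : USphere d) : USphere d :=
  ⟨e u, by simp [e.norm_map]⟩

theorem continuous_sphereMap (e : Vec d ≃ₗᵢ[ℝ] Vec d) : Continuous (sphereMap e) :=
  (e.continuous.comp continuous_subtype_val).subtype_mk _

theorem map_toSphere (e : Vec d ≃ₗᵢ[ℝ] Vec d) :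
    (volume : Measure (Vec d)).toSphere.map (sphereMap e) = (volume : Measure (Vec d)).toSphere := by
  ext s hs
  have hm := (continuous_sphereMap e).measurable
  rw [Measure.map_apply hm hs, Measure.toSphere_apply' _ (hm hs), Measure.toSphere_apply' _ hs]
  congr 1
  have hset : Set.Ioo (0 : ℝ) 1 • (((↑) : USphere d → Vec d) '' (sphereMap e ⁻¹' s))
      = e ⁻¹' (Set.Ioo (0 : ℝ) 1 • (((↑) : USphere d → Vec d) '' s)) := by
    ext v
    simp only [Set.mem_smul, Set.mem_image, Set.mem_preimage]
    constructor
    · rintro ⟨r, hr, -, ⟨u, hu, rfl⟩, rfl⟩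
      exact ⟨r, hr, e u, ⟨sphereMap e u, hu, rfl⟩, by simp⟩
    · rintro ⟨r, hr, -, ⟨u, hu, rfl⟩, hv⟩
      refine ⟨r, hr, e.symm u, ⟨sphereMap e.symm u, ?_, rfl⟩, ?_⟩
      · have : sphereMap e (sphereMap e.symm u) = u := by
          apply Subtype.ext
          simp [sphereMap]
        rwa [this]
      · apply e.injective
        simpa using hv
  rw [hset]
  exact (e.measurePreserving).measure_preimage_emb e.toHomeomorph.measurableEmbedding _

theorem map_unifSphere (e : Vec d ≃ₗᵢ[ℝ] Vec d) : (unifSphere d).map (sphereMap e) = unifSphere d := by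
  rw [unifSphere, Measure.map_smul, map_toSphere]

theorem integral_unifSphere_comp (e : Vec d ≃ₗᵢ[ℝ] Vec d) {g : USphere d → ℝ} (hg : Continuous g) :
    ∫ u, g (sphereMap e u) ∂unifSphere d = ∫ u, g u ∂unifSphere d := by
  conv_rhs => rw [← map_unifSphere e]
  rw [integral_map (continuous_sphereMap e).aemeasurable hg.aestronglyMeasurable]

theorem isProbabilityMeasure_unifSphere (hd : 1 ≤ d) : IsProbabilityMeasure (unifSphere d) := by
  have : Nonempty (Fin d) := ⟨⟨0, hd⟩⟩
  refine ⟨?_⟩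
  rw [unifSphere, Measure.smul_apply, smul_eq_mul]
  refine ENNReal.inv_mul_cancel ?_ (measure_ne_top _ _)
  rw [Ne, Measure.measure_univ_eq_zero]
  exact Measure.toSphere_ne_zero _

instance isFiniteMeasure_unifSphere : IsFiniteMeasure (unifSphere d) := by
  rcases Nat.eq_zero_or_pos d with rfl | hd
  · have : IsEmpty (USphere 0) := ⟨fun u => by
      have h1 : ‖(u : Vec 0)‖ = 1 := by simp
      rw [Subsingleton.elim (u : Vec 0) 0, norm_zero] at h1
      exact zero_ne_one h1⟩
    infer_instance
  · have := isProbabilityMeasure_unifSphere hd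
    infer_instance

theorem continuous_coord (i : Fin d) : Continuous fun u : USphere d => (u : Vec d) i := by
  fun_prop

theorem integrable_of_continuous {g : USphere d → ℝ} (hg : Continuous g) :
    Integrable g (unifSphere d) :=
  hg.integrable_of_hasCompactSupport (HasCompactSupport.of_compactSpace g)

/-- The reflection of the `i`-th coordinate. -/
def reflectCoord (i : Fin d) : Vec d ≃ₗᵢ[ℝ] Vec d :=
  LinearIsometryEquiv.piLpCongrRight 2 fun j =>
    if j = i then LinearIsometryEquiv.neg ℝ else LinearIsometryEquiv.refl ℝ ℝ

theorem integral_coord_mul_coord_of_ne {i j : Fin d} (h : i ≠ j) :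
    ∫ u, (u : Vec d) i * (u : Vec d) j ∂unifSphere d = 0 := by
  have h1 := integral_unifSphere_comp (reflectCoord i) (g := fun u => (u : Vec d) i * (u : Vec d) j)
    ((continuous_coord i).mul (continuous_coord j))
  have e : ∀ u : USphere d, ((sphereMap (reflectCoord i) u : USphere d) : Vec d) i *
      ((sphereMap (reflectCoord i) u : USphere d) : Vec d) j = -((u : Vec d) i * (u : Vec d) j) := by
    intro u
    simp [sphereMap, reflectCoord, h.symm]
  simp only [e, integral_neg] at h1
  linarith

theorem integral_coord_sq_eq (i j : Fin d) :
    ∫ u, (u : Vec d) i ^ 2 ∂unifSphere d = ∫ u, (u : Vec d) j ^ 2 ∂unifSphere d := by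
  have h1 := integral_unifSphere_comp
    (LinearIsometryEquiv.piLpCongrLeft 2 ℝ ℝ (Equiv.swap i j)) (g := fun u => (u : Vec d) i ^ 2)
    ((continuous_coord i).pow 2)
  rw [← h1]
  simp [sphereMap, LinearIsometryEquiv.piLpCongrLeft_apply]

theorem integral_coord_sq (hd : 1 ≤ d) (i : Fin d) :
    ∫ u, (u : Vec d) i ^ 2 ∂unifSphere d = 1 / d := by
  have := isProbabilityMeasure_unifSphere hd
  have h1 : ∑ j, ∫ u, (u : Vec d) j ^ 2 ∂unifSphere d = 1 := by
    rw [← integral_finsetSum _ fun j _ =>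
      integrable_of_continuous (g := fun u : USphere d => (u : Vec d) j ^ 2) (by fun_prop)]
    have : ∀ u : USphere d, ∑ j, (u : Vec d) j ^ 2 = 1 := fun u => by
      rw [← EuclideanSpace.real_norm_sq_eq, show ‖(u : Vec d)‖ = 1 by simp, one_pow]
    simp [this]
  simp only [fun j => integral_coord_sq_eq j i, Finset.sum_const, Finset.card_univ,
    Fintype.card_fin, nsmul_eq_mul] at h1
  have hd' : (d : ℝ) ≠ 0 := by exact_mod_cast (by omega : d ≠ 0)
  field_simp
  linarith

theorem quad_eq_sum (Q : Mat d) (v : Vec d) : quad Q v = ∑ i, ∑ j, Q i j * (v i * v j) := by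
  simp only [quad, dotProduct, Matrix.mulVec, Finset.mul_sum]
  exact Finset.sum_congr rfl fun i _ => Finset.sum_congr rfl fun j _ => by ring

theorem continuous_quad_coe (Q : Mat d) : Continuous fun u : USphere d => quad Q (u : Vec d) := by
  simp only [quad_eq_sum]
  fun_prop

/-- A quadratic form averages over the unit sphere to its trace divided by `d`: reflections kill the
mixed moments, permutations make the second moments equal. -/
theorem integral_quad (hd : 1 ≤ d) (Q : Mat d) :
    ∫ u, quad Q (u : Vec d) ∂unifSphere d = Q.trace / d := by
  simp only [quad_eq_sum]
  have hint : ∀ i j, Integrable (fun u : USphere d => Q i j * ((u : Vec d) i * (u : Vec d) j))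
      (unifSphere d) := fun i j => integrable_of_continuous (by fun_prop)
  rw [integral_finsetSum _ fun i _ => integrable_finsetSum _ fun j _ => hint i j]
  have : ∀ i, ∫ u, ∑ j, Q i j * ((u : Vec d) i * (u : Vec d) j) ∂unifSphere d = Q i i * (1 / d) := by
    intro i
    rw [integral_finsetSum _ fun j _ => hint i j, Finset.sum_eq_single i]
    · rw [integral_const_mul, ← integral_coord_sq hd i]
      simp only [sq]
    · intro j _ hj
      rw [integral_const_mul, integral_coord_mul_coord_of_ne hj.symm, mul_zero]
    · simp
  simp only [this, ← Finset.sum_mul]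
  rw [Matrix.trace]
  simp [div_eq_mul_inv]

end

/-! ### Chains driven by random directions -/

section

open scoped ENNReal
open MeasureTheory ProbabilityTheory

variable {d : ℕ} {f : Vec d → ℝ} {M μ L κ : ℝ} {x₀ : Vec d}

/-- Freezing: an independent variable may be integrated out first. -/
theorem lintegral_comp_of_indepFun {Ω S T : Type*} [MeasurableSpace Ω] [MeasurableSpace S]
    [MeasurableSpace T] {P : Measure Ω} [IsProbabilityMeasure P] {X : Ω → S} {Y : Ω → T}
    (hX : Measurable X) (hY : Measurable Y) (hXY : IndepFun X Y P) {F : S × T → ℝ≥0∞}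
    (hF : Measurable F) :
    ∫⁻ ω, F (X ω, Y ω) ∂P = ∫⁻ ω, ∫⁻ y, F (X ω, y) ∂(P.map Y) ∂P := by
  have := Measure.isProbabilityMeasure_map (μ := P) hY.aemeasurable
  rw [← lintegral_map (f := F) (g := fun ω => (X ω, Y ω)) hF (hX.prodMk hY),
    (indepFun_iff_map_prod_eq_prod_map_map hX.aemeasurable hY.aemeasurable).1 hXY,
    lintegral_prod _ hF.aemeasurable, lintegral_map hF.lintegral_prod_right' hX]

/-- The `k`-th state of a chain driven by independent innovations depends on the first `k`
innovations only. -/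
theorem measurable_chain {Ω S T : Type*} [MeasurableSpace S] [MeasurableSpace T]
    {u : ℕ → Ω → T} {step : S → T → S} (hstep : Measurable (Function.uncurry step))
    {s : ℕ → Ω → S} {s₀ : S} (h0 : ∀ ω, s 0 ω = s₀)
    (hsucc : ∀ k ω, s (k + 1) ω = step (s k ω) (u k ω)) (k : ℕ) :
    Measurable[⨆ i ∈ Set.Iio k, MeasurableSpace.comap (u i) inferInstance] (s k) := by
  induction k with
  | zero =>
    rw [show s 0 = fun _ => s₀ from funext h0]
    exact measurable_const
  | succ k ih =>
    rw [show s (k + 1) = fun ω => Function.uncurry step (s k ω, u k ω) from funext (hsucc k)]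
    refine hstep.comp (Measurable.prodMk (ih.mono ?_ le_rfl) ?_)
    · exact biSup_mono fun i hi => Set.mem_Iio.2 ((Set.mem_Iio.1 hi).trans (Nat.lt_succ_self k))
    · exact (comap_measurable (u k)).mono
        (le_biSup (fun i => MeasurableSpace.comap (u i) inferInstance)
          (Set.mem_Iio.2 (Nat.lt_succ_self k))) le_rfl

theorem chain_indepFun {Ω S T : Type*} [MeasurableSpace Ω] [MeasurableSpace S]
    [MeasurableSpace T] {P : Measure Ω} {u : ℕ → Ω → T} (hm : ∀ k, Measurable (u k))
    (hu : iIndepFun u P) {step : S → T → S} (hstep : Measurable (Function.uncurry step))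
    {s : ℕ → Ω → S} {s₀ : S} (h0 : ∀ ω, s 0 ω = s₀)
    (hsucc : ∀ k ω, s (k + 1) ω = step (s k ω) (u k ω)) (k : ℕ) :
    Measurable (s k) ∧ IndepFun (s k) (u k) P := by
  have hle : ∀ i, MeasurableSpace.comap (u i) inferInstance ≤ ‹MeasurableSpace Ω› :=
    fun i => (hm i).comap_le
  have hsk := measurable_chain hstep h0 hsucc k
  refine ⟨hsk.mono (iSup₂_le fun i _ => hle i) le_rfl, ?_⟩
  have hind := indep_iSup_of_disjoint hle ((iIndepFun_iff_iIndep _ _ _).1 hu)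
    (S := Set.Iio k) (T := {k}) (by simp)
  rw [IndepFun_iff_Indep]
  refine indep_of_indep_of_le_left (indep_of_indep_of_le_right hind ?_) hsk.comap_le
  exact le_biSup (fun i => MeasurableSpace.comap (u i) inferInstance) (Set.mem_singleton k)

/-- The union bound over all times at once: Markov's inequality at time `i` fails with probability
at most `a (p / q)^i / c`, and these probabilities have a finite sum. -/
theorem measure_exists_lt_le {Ω : Type*} [MeasurableSpace Ω] {P : Measure Ω} {X : ℕ → Ω → ℝ}
    (hX : ∀ i, Measurable (X i)) {a c p q : ℝ} (ha : 0 ≤ a) (hc : 0 < c) (hp : 0 ≤ p) (hq : 0 < q)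
    (hpq : p < q) (h : ∀ i, ∫⁻ ω, ENNReal.ofReal (X i ω) ∂P ≤ ENNReal.ofReal (a * p ^ i)) :
    P {ω | ∃ i, c * q ^ i < X i ω} ≤ ENNReal.ofReal (a / c * (1 - p / q)⁻¹) := by
  have hr0 : 0 ≤ p / q := div_nonneg hp hq.le
  have hr1 : p / q < 1 := (div_lt_one hq).2 hpq
  have hone : ∀ i, P {ω | c * q ^ i < X i ω} ≤ ENNReal.ofReal (a / c * (p / q) ^ i) := by
    intro i
    have hpos : 0 < c * q ^ i := by positivity
    have h1 := mul_meas_ge_le_lintegral (μ := P) (hX i).ennreal_ofReal (ENNReal.ofReal (c * q ^ i))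
    have h2 : P {ω | c * q ^ i < X i ω} ≤
        P {ω | ENNReal.ofReal (c * q ^ i) ≤ ENNReal.ofReal (X i ω)} :=
      measure_mono fun ω hω => ENNReal.ofReal_le_ofReal (le_of_lt hω)
    have h3 : ENNReal.ofReal (c * q ^ i) * P {ω | c * q ^ i < X i ω} ≤ ENNReal.ofReal (a * p ^ i) :=
      (mul_le_mul_right h2 _).trans (h1.trans (h i))
    have e : a / c * (p / q) ^ i = (a * p ^ i) / (c * q ^ i) := by rw [div_pow]; field_simp
    rw [e, ENNReal.ofReal_div_of_pos hpos, ENNReal.le_div_iff_mul_le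
      (Or.inl (ENNReal.ofReal_pos.2 hpos).ne') (Or.inl ENNReal.ofReal_ne_top), mul_comm]
    exact h3
  have hset : {ω | ∃ i, c * q ^ i < X i ω} = ⋃ i, {ω | c * q ^ i < X i ω} := by
    ext ω; simp
  rw [hset]
  refine (measure_iUnion_le _).trans ((ENNReal.tsum_le_tsum hone).trans ?_)
  rw [← ENNReal.ofReal_tsum_of_nonneg (fun i => by positivity)
    ((summable_geometric_of_lt_one hr0 hr1).mul_left _), tsum_mul_left,
    tsum_geometric_of_lt_one hr0 hr1]

theorem ofReal_one_sub_le_measure {Ω : Type*} [MeasurableSpace Ω] {P : Measure Ω}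
    [IsProbabilityMeasure P] {s t : Set Ω} {δ : ℝ} (hδ : 0 ≤ δ) (ht : P t ≤ ENNReal.ofReal δ)
    (h : ∀ ω, ω ∉ t → ω ∈ s) : ENNReal.ofReal (1 - δ) ≤ P s := by
  rw [ENNReal.ofReal_sub _ hδ, ENNReal.ofReal_one, tsub_le_iff_right]
  calc (1 : ℝ≥0∞) = P Set.univ := measure_univ.symm
    _ ≤ P (s ∪ t) := measure_mono fun ω _ => by
        by_cases hω : ω ∈ t
        · exact Or.inr hω
        · exact Or.inl (h ω hω)
    _ ≤ P s + P t := measure_union_le _ _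
    _ ≤ P s + ENNReal.ofReal δ := by gcongr

/-- One random step contracts the Lyapunov function in expectation. -/
theorem lintegral_lyapunov_le (hs : Setting M μ L κ f x₀) (hκ : 1 ≤ κ) (hd : 2 ≤ d)
    {W : Vec d → Mat d} (hW : IsWeight f M κ W) {k : ℕ} {x : Vec d} {G : Mat d}
    (h : LinearPhase f M κ x₀ k x G) {G' : USphere d → Mat d} {Q : Mat d}
    (hQ : Q.trace =
      (W (nextPoint f x G) * (corr f M x G • G - hess f (nextPoint f x G))).trace)
    (hdec : ∀ u : USphere d, (W (nextPoint f x G) * (G' u - hess f (nextPoint f x G))).trace ≤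
      (W (nextPoint f x G) * (corr f M x G • G - hess f (nextPoint f x G))).trace - quad Q u)
    (h' : ∀ u, LinearPhase f M κ x₀ (k + 1) (nextPoint f x G) (G' u)) :
    ∫⁻ u, ENNReal.ofReal (lyapunov f M κ W (nextPoint f x G) (G' u)) ∂unifSphere d ≤
      ENNReal.ofReal (contractionFactor d κ (M * lam f x₀) k) *
        ENNReal.ofReal (lyapunov f M κ W x G) := by
  have hd1 : 1 ≤ d := by omega
  have := isProbabilityMeasure_unifSphere hd1
  have hl0 : 0 ≤ M * lam f x₀ := mul_nonneg hs.self_conc.M_pos.le (lam_nonneg f x₀)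
  have hcon := h.contraction hs hκ hd hW
  obtain ⟨y, hy⟩ : ∃ y, y = nextPoint f x G := ⟨_, rfl⟩
  simp only [← hy] at *
  obtain ⟨σ, hσ⟩ : ∃ σ, σ = (W y * (corr f M x G • G - hess f y)).trace := ⟨_, rfl⟩
  simp only [← hσ] at *
  have hle : ∀ u, lyapunov f M κ W y (G' u) ≤
      (σ + 3 * (d * κ) * (M * lam f y)) - quad Q (u : Vec d) := fun u => by
    have := hdec u
    rw [lyapunov]
    linarith
  calc ∫⁻ u, ENNReal.ofReal (lyapunov f M κ W y (G' u)) ∂unifSphere d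
      ≤ ∫⁻ u, ENNReal.ofReal ((σ + 3 * (d * κ) * (M * lam f y)) - quad Q (u : Vec d))
          ∂unifSphere d := lintegral_mono fun u => ENNReal.ofReal_le_ofReal (hle u)
    _ = ENNReal.ofReal (∫ u, ((σ + 3 * (d * κ) * (M * lam f y)) - quad Q (u : Vec d))
          ∂unifSphere d) := by
        rw [ofReal_integral_eq_lintegral_ofReal]
        · exact integrable_of_continuous (continuous_const.sub (continuous_quad_coe Q))
        · exact Filter.Eventually.of_forall fun u => ((h' u).lyapunov_nonneg hs hκ hW).trans (hle u)
    _ = ENNReal.ofReal ((1 - 1 / d) * σ + 3 * (d * κ) * (M * lam f y)) := by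
        rw [integral_sub (integrable_const _) (integrable_of_continuous (continuous_quad_coe Q)),
          integral_quad hd1, hQ]
        congr 1
        simp
        ring
    _ ≤ ENNReal.ofReal (contractionFactor d κ (M * lam f x₀) k * lyapunov f M κ W x G) :=
        ENNReal.ofReal_le_ofReal hcon
    _ = _ := ENNReal.ofReal_mul (contractionFactor_nonneg hd1 hκ hl0 k)

/-- Superlinear convergence with high probability of a method whose states form a chain driven by
uniform directions, and whose updates lower the corrected potential by at least a quadratic form of
the direction that has the corrected potential as its trace. -/
theorem measure_superlinearFrom_ge (hs : Setting M μ L κ f x₀) (hκ : 1 ≤ κ) (hd : 2 ≤ d)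
    {δ : ℝ} (hδ : 0 < δ) {W : Vec d → Mat d} (hW : IsWeight f M κ W)
    {Ω S : Type*} [MeasurableSpace Ω] [MeasurableSpace S] {P : Measure Ω} [IsProbabilityMeasure P]
    {u : ℕ → Ω → USphere d} (hu : IsIIDUnifSphere P u)
    {step : S → USphere d → S} (hstep : Measurable (Function.uncurry step))
    {pt : S → Vec d} {mat : S → Mat d}
    (hmeas : Measurable fun s => lyapunov f M κ W (pt s) (mat s))
    (hnext : ∀ s w, pt (step s w) = nextPoint f (pt s) (mat s))
    {good : ℕ → S → Prop} (hgood : ∀ k s w, good k s → good (k + 1) (step s w))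
    (hphase : ∀ k s, good k s → LinearPhase f M κ x₀ k (pt s) (mat s))
    (hdec : ∀ k s, good k s → ∃ Q : Mat d,
      Q.trace = (W (nextPoint f (pt s) (mat s)) * (corr f M (pt s) (mat s) • mat s
        - hess f (nextPoint f (pt s) (mat s)))).trace ∧
      ∀ w : USphere d, (W (nextPoint f (pt s) (mat s)) * (mat (step s w)
        - hess f (nextPoint f (pt s) (mat s)))).trace ≤
        (W (nextPoint f (pt s) (mat s)) * (corr f M (pt s) (mat s) • mat s
          - hess f (nextPoint f (pt s) (mat s)))).trace - quad Q w)
    {s : ℕ → Ω → S} {s₀ : S} (h0 : ∀ ω, s 0 ω = s₀) (hpt : pt s₀ = x₀) (hgood0 : good 0 s₀)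
    (hsucc : ∀ k ω, s (k + 1) ω = step (s k ω) (u k ω)) :
    ENNReal.ofReal (1 - δ) ≤ P {ω | SuperlinearFrom f (1 - 1 / (d + 1)) κ
      (firstStage d κ + secondStage d κ δ) fun k => pt (s k ω)} := by
  have hd1 : 1 ≤ d := by omega
  have hd' : (2 : ℝ) ≤ d := by exact_mod_cast hd
  have hl0 : 0 ≤ M * lam f x₀ := mul_nonneg hs.self_conc.M_pos.le (lam_nonneg f x₀)
  have hg : ∀ k ω, good k (s k ω) := by
    intro k ω
    induction k with
    | zero => rw [h0]; exact hgood0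
    | succ k ih => rw [hsucc]; exact hgood k _ _ ih
  have hphase' := fun k ω => hphase k _ (hg k ω)
  have hchain := chain_indepFun hu.measurable hu.indep hstep h0 hsucc
  have hcontr : ∀ k, ∫⁻ ω, ENNReal.ofReal (lyapunov f M κ W (pt (s (k + 1) ω)) (mat (s (k + 1) ω))) ∂P
      ≤ ENNReal.ofReal (contractionFactor d κ (M * lam f x₀) k) *
        ∫⁻ ω, ENNReal.ofReal (lyapunov f M κ W (pt (s k ω)) (mat (s k ω))) ∂P := by
    intro k
    have hF : Measurable fun z : S × USphere d => ENNReal.ofReal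
        (lyapunov f M κ W (pt (step z.1 z.2)) (mat (step z.1 z.2))) :=
      (hmeas.comp hstep).ennreal_ofReal
    have h1 := lintegral_comp_of_indepFun (hchain k).1 (hu.measurable k) (hchain k).2 hF
    simp only [hsucc]
    rw [h1, hu.law, ← lintegral_const_mul' _ _ ENNReal.ofReal_ne_top]
    refine lintegral_mono fun ω => ?_
    obtain ⟨Q, hQ, hQ'⟩ := hdec k _ (hg k ω)
    simp only [hnext]
    exact lintegral_lyapunov_le hs hκ hd hW (hphase' k ω) hQ hQ' fun w => by
      rw [← hnext (s k ω) w]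
      exact hphase _ _ (hgood k _ _ (hg k ω))
  have hT := geometric_decay hd1 hκ hl0 (hs.init_le hκ) (B := 3 / 2 * (d * κ ^ 2)) (by positivity)
    (fun k => by
      calc ∫⁻ ω, ENNReal.ofReal (lyapunov f M κ W (pt (s k ω)) (mat (s k ω))) ∂P
          ≤ ∫⁻ _ω, ENNReal.ofReal (3 / 2 * (d * κ ^ 2)) ∂P :=
            lintegral_mono fun ω => ENNReal.ofReal_le_ofReal ((hphase' k ω).lyapunov_le hs hκ hW)
        _ = _ := by simp) hcontr
  obtain ⟨k₀, hk₀⟩ : ∃ k₀, k₀ = firstStage d κ + secondStage d κ δ := ⟨_, rfl⟩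
  have hp := one_sub_one_div_nonneg hd1
  have hq : 0 < 1 - 1 / ((d : ℝ) + 1) := by
    rw [sub_pos, div_lt_one (by linarith)]; linarith
  have hpq : 1 - 1 / (d : ℝ) < 1 - 1 / ((d : ℝ) + 1) :=
    sub_lt_sub_left (one_div_lt_one_div_of_lt (by linarith) (by linarith)) 1
  have hbad := measure_exists_lt_le (P := P)
    (X := fun i ω => lyapunov f M κ W (pt (s (k₀ + i) ω)) (mat (s (k₀ + i) ω)))
    (fun i => hmeas.comp (hchain (k₀ + i)).1)
    (a := 3 * (1 - 1 / d) ^ secondStage d κ δ * (3 / 2 * (d * κ ^ 2))) (c := 2 / 5)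
    (p := 1 - 1 / d) (q := 1 - 1 / (d + 1)) (by positivity) (by norm_num) hp hq hpq
    (fun i => by
      refine (hk₀ ▸ add_assoc (firstStage d κ) _ i ▸ hT (secondStage d κ δ + i)).trans
        (ENNReal.ofReal_le_ofReal (le_of_eq ?_))
      rw [pow_add]
      ring)
  rw [← hk₀]
  refine ofReal_one_sub_le_measure hδ.le (hbad.trans (ENNReal.ofReal_le_ofReal ?_)) fun ω hω => ?_
  · have h2 := one_sub_inv_pow_secondStage_le hd1 hκ hδ
    -- The ratio of the two rates is `1 - 1 / d²`.
    have e : (1 - (1 - 1 / (d : ℝ)) / (1 - 1 / ((d : ℝ) + 1)))⁻¹ = d ^ 2 := by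
      have h3 : (d : ℝ) ≠ 0 := by positivity
      have h4 : (d : ℝ) + 1 ≠ 0 := by positivity
      have e1 : 1 - (1 - 1 / (d : ℝ)) / (1 - 1 / ((d : ℝ) + 1)) = ((d : ℝ) ^ 2)⁻¹ := by
        have e2 : 1 - 1 / ((d : ℝ) + 1) = d / (d + 1) := by field_simp; ring
        rw [e2]
        field_simp
        ring
      rw [e1, inv_inv]
    rw [e]
    calc 3 * (1 - 1 / (d : ℝ)) ^ secondStage d κ δ * (3 / 2 * (d * κ ^ 2)) / (2 / 5) * d ^ 2
        ≤ 3 * (12 * (d ^ 3 * κ ^ 2 / δ))⁻¹ * (3 / 2 * (d * κ ^ 2)) / (2 / 5) * d ^ 2 := by gcongr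
      _ = 15 / 16 * δ := by field_simp; norm_num
      _ ≤ δ := by linarith
  · simp only [Set.mem_ofPred_eq, not_exists, not_lt] at hω
    exact superlinearFrom_of_lyapunov_le hs hκ hd1 hW (x := fun k => pt (s k ω))
      (G := fun k => mat (s k ω)) (by simp only [h0, hpt])
      (fun k => by simp only [hsucc, hnext]) (fun k => hphase' k ω) hq.le hω

end

/-! ### Measurability of the methods -/

section

open scoped Matrix
open MeasureTheory

variable {d : ℕ} {f : Vec d → ℝ} {α : Type*} [MeasurableSpace α]

/-- Matrices carry the product σ-algebra of their entries. -/
instance Mat.measurableSpace : MeasurableSpace (Mat d) := inferInstanceAs (MeasurableSpace (Fin d → Fin d → ℝ))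

/-- States carry the σ-algebra generated by their components. -/
instance SR1State.measurableSpace : MeasurableSpace (SR1State d) :=
  MeasurableSpace.comap (fun s => (s.x, s.G)) inferInstance

/-- States carry the σ-algebra generated by their components. -/
instance BFGSState.measurableSpace : MeasurableSpace (BFGSState d) :=
  MeasurableSpace.comap (fun s => (s.x, s.G, s.F)) inferInstance

theorem measurable_mat_iff {A : α → Mat d} :
    Measurable A ↔ ∀ i j, Measurable fun a => A a i j :=
  measurable_pi_iff.trans (forall_congr' fun _ => measurable_pi_iff)

theorem measurable_entry {A : α → Mat d} (hA : Measurable A) (i j : Fin d) :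
    Measurable fun a => A a i j := measurable_mat_iff.1 hA i j

theorem measurable_vec_iff {v : α → Vec d} : Measurable v ↔ ∀ i, Measurable fun a => v a i :=
  ⟨fun h i => ((measurable_pi_apply i).comp (WithLp.measurable_ofLp 2 _)).comp h,
    fun h => (WithLp.measurable_toLp 2 _).comp (measurable_pi_iff.2 h)⟩

theorem measurable_coord {v : α → Vec d} (hv : Measurable v) (i : Fin d) :
    Measurable fun a => v a i := measurable_vec_iff.1 hv i

theorem measurable_app {A : α → Mat d} {v : α → Vec d} (hA : Measurable A) (hv : Measurable v) :
    Measurable fun a => app (A a) (v a) :=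
  measurable_vec_iff.2 fun i =>
    show Measurable fun a => ∑ j, A a i j * v a j from
      Finset.measurable_fun_sum _ fun j _ => (measurable_entry hA i j).mul (measurable_coord hv j)

theorem measurable_quad {A : α → Mat d} {v : α → Vec d} (hA : Measurable A) (hv : Measurable v) :
    Measurable fun a => quad (A a) (v a) :=
  show Measurable fun a => ∑ i, v a i * app (A a) (v a) i from
    Finset.measurable_fun_sum _ fun i _ =>
      (measurable_coord hv i).mul (measurable_coord (measurable_app hA hv) i)

theorem measurable_normOf {A : α → Mat d} {v : α → Vec d} (hA : Measurable A) (hv : Measurable v) :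
    Measurable fun a => normOf (A a) (v a) := (measurable_quad hA hv).sqrt

theorem measurable_outer {u v : α → Vec d} (hu : Measurable u) (hv : Measurable v) :
    Measurable fun a => outer (u a) (v a) :=
  measurable_mat_iff.2 fun i j => (measurable_coord hu i).mul (measurable_coord hv j)

theorem measurable_mat_add {A B : α → Mat d} (hA : Measurable A) (hB : Measurable B) :
    Measurable fun a => A a + B a :=
  measurable_mat_iff.2 fun i j => (measurable_entry hA i j).add (measurable_entry hB i j)

theorem measurable_mat_sub {A B : α → Mat d} (hA : Measurable A) (hB : Measurable B) :
    Measurable fun a => A a - B a :=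
  measurable_mat_iff.2 fun i j => (measurable_entry hA i j).sub (measurable_entry hB i j)

theorem measurable_mat_smul {c : α → ℝ} {A : α → Mat d} (hc : Measurable c) (hA : Measurable A) :
    Measurable fun a => c a • A a :=
  measurable_mat_iff.2 fun i j => hc.mul (measurable_entry hA i j)

theorem measurable_mat_mul {A B : α → Mat d} (hA : Measurable A) (hB : Measurable B) :
    Measurable fun a => A a * B a :=
  measurable_mat_iff.2 fun i j => by
    simp only [Matrix.mul_apply]
    exact Finset.measurable_fun_sum _ fun k _ =>
      (measurable_entry hA i k).mul (measurable_entry hB k j)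

theorem measurable_trace {A : α → Mat d} (hA : Measurable A) : Measurable fun a => (A a).trace :=
  Finset.measurable_fun_sum _ fun i _ => measurable_entry hA i i

theorem measurable_transpose {A : α → Mat d} (hA : Measurable A) : Measurable fun a => (A a)ᵀ :=
  measurable_mat_iff.2 fun i j => measurable_entry hA j i

theorem measurable_det {A : α → Mat d} (hA : Measurable A) : Measurable fun a => (A a).det := by
  simp only [Matrix.det_apply']
  exact Finset.measurable_fun_sum _ fun σ _ =>
    (Finset.measurable_fun_prod _ fun i _ => measurable_entry hA (σ i) i).const_mul _

theorem measurable_mat_inv {A : α → Mat d} (hA : Measurable A) : Measurable fun a => (A a)⁻¹ := by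
  simp only [Matrix.inv_def, Ring.inverse_eq_inv']
  refine measurable_mat_smul (measurable_det hA).inv (measurable_mat_iff.2 fun i j => ?_)
  simp only [Matrix.adjugate_apply]
  refine measurable_det (measurable_mat_iff.2 fun k l => ?_)
  simp only [Matrix.updateRow_apply]
  split_ifs
  · exact measurable_const
  · exact measurable_entry hA k l

theorem measurable_gradient (f : Vec d → ℝ) : Measurable (gradient f) :=
  (InnerProductSpace.toDual ℝ (Vec d)).symm.continuous.measurable.comp (measurable_fderiv ℝ f)

theorem measurable_hess (f : Vec d → ℝ) : Measurable (hess f) :=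
  measurable_mat_iff.2 fun i j =>
    (ContinuousLinearMap.apply ℝ ℝ (stdVec j)).continuous.measurable.comp
      (measurable_fderiv_apply_const ℝ (fderiv ℝ f) (stdVec i))

theorem measurable_lam (f : Vec d → ℝ) : Measurable (lam f) :=
  measurable_normOf (measurable_mat_inv (measurable_hess f)) (measurable_gradient f)

theorem measurable_sr1 {G A : α → Mat d} {u : α → Vec d} (hG : Measurable G) (hA : Measurable A)
    (hu : Measurable u) : Measurable fun a => sr1 (G a) (A a) (u a) := by
  unfold sr1
  have hR := measurable_mat_sub hG hA
  have hRu := measurable_app hR hu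
  exact Measurable.ite (measurableSet_eq_fun (measurable_app hG hu) (measurable_app hA hu)) hG
    (measurable_mat_sub hG (measurable_mat_smul (measurable_quad hR hu).inv
      (measurable_outer hRu hRu)))

theorem measurable_bfgs {G A : α → Mat d} {u : α → Vec d} (hG : Measurable G) (hA : Measurable A)
    (hu : Measurable u) : Measurable fun a => bfgs (G a) (A a) (u a) := by
  have hGu := measurable_app hG hu
  have hAu := measurable_app hA hu
  exact measurable_mat_add (measurable_mat_sub hG
    (measurable_mat_smul (measurable_quad hG hu).inv (measurable_outer hGu hGu)))
    (measurable_mat_smul (measurable_quad hA hu).inv (measurable_outer hAu hAu))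

theorem measurable_factorUpdate {F A : α → Mat d} {w : α → Vec d} (hF : Measurable F)
    (hA : Measurable A) (hw : Measurable w) : Measurable fun a => factorUpdate (F a) (A a) (w a) := by
  have hu := measurable_app (measurable_transpose hF) hw
  have hv : Measurable fun a => (normOf (A a) (app (F a)ᵀ (w a)) / ‖w a‖) • w a :=
    ((measurable_normOf hA hu).div hw.norm).smul hw
  exact measurable_mat_sub hF (measurable_mat_smul (measurable_quad hA hu).inv
    (measurable_outer ((measurable_app hF (measurable_app hA hu)).sub hv) hu))

theorem measurable_nextPoint (f : Vec d → ℝ) {x : α → Vec d} {G : α → Mat d} (hx : Measurable x)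
    (hG : Measurable G) : Measurable fun a => nextPoint f (x a) (G a) :=
  hx.sub (measurable_app (measurable_mat_inv hG) ((measurable_gradient f).comp hx))

theorem measurable_corr (f : Vec d → ℝ) (M : ℝ) {x : α → Vec d} {G : α → Mat d}
    (hx : Measurable x) (hG : Measurable G) : Measurable fun a => corr f M (x a) (G a) :=
  ((measurable_normOf ((measurable_hess f).comp hx)
    ((measurable_nextPoint f hx hG).sub hx)).const_mul M).const_add 1

theorem measurable_lyapunov (f : Vec d → ℝ) (M κ : ℝ) {W : Vec d → Mat d} (hW : Measurable W)
    {x : α → Vec d} {G : α → Mat d} (hx : Measurable x) (hG : Measurable G) :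
    Measurable fun a => lyapunov f M κ W (x a) (G a) :=
  (measurable_trace (measurable_mat_mul (hW.comp hx)
    (measurable_mat_sub hG ((measurable_hess f).comp hx)))).add
    ((((measurable_lam f).comp hx).const_mul M).const_mul _)

theorem SR1State.measurable_x_G : Measurable fun s : SR1State d => (s.x, s.G) :=
  comap_measurable _

theorem BFGSState.measurable_x_G_F : Measurable fun s : BFGSState d => (s.x, s.G, s.F) :=
  comap_measurable _

/-- One iteration of the SR1 method, for a direction on the unit sphere. -/
def sr1Step (f : Vec d → ℝ) (M : ℝ) (s : SR1State d) (u : USphere d) : SR1State d :=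
  ⟨nextPoint f s.x s.G, sr1 (s.Gcorr f M) (hess f (nextPoint f s.x s.G)) u⟩

/-- One iteration of the BFGS method, for an unscaled direction on the unit sphere. -/
def bfgsStep (f : Vec d → ℝ) (M : ℝ) (s : BFGSState d) (w : USphere d) : BFGSState d :=
  ⟨nextPoint f s.x s.G,
    bfgs (s.Gcorr f M) (hess f (nextPoint f s.x s.G)) (app (s.Fcorr f M)ᵀ w),
    factorUpdate (s.Fcorr f M) (hess f (nextPoint f s.x s.G)) w⟩

theorem measurable_sr1Step (f : Vec d → ℝ) (M : ℝ) : Measurable (Function.uncurry (sr1Step f M)) := by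
  have hs : Measurable fun z : SR1State d × USphere d => (z.1.x, z.1.G) :=
    SR1State.measurable_x_G.comp measurable_fst
  have hx : Measurable fun z : SR1State d × USphere d => z.1.x := measurable_fst.comp hs
  have hG : Measurable fun z : SR1State d × USphere d => z.1.G := measurable_snd.comp hs
  have hu : Measurable fun z : SR1State d × USphere d => (z.2 : Vec d) :=
    measurable_subtype_coe.comp measurable_snd
  have hy := measurable_nextPoint f hx hG
  exact measurable_comap_iff.2 (hy.prodMk (measurable_sr1
    (measurable_mat_smul (measurable_corr f M hx hG) hG) ((measurable_hess f).comp hy) hu))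

theorem measurable_bfgsStep (f : Vec d → ℝ) (M : ℝ) :
    Measurable (Function.uncurry (bfgsStep f M)) := by
  have hs : Measurable fun z : BFGSState d × USphere d => (z.1.x, z.1.G, z.1.F) :=
    BFGSState.measurable_x_G_F.comp measurable_fst
  have hx : Measurable fun z : BFGSState d × USphere d => z.1.x := measurable_fst.comp hs
  have hG : Measurable fun z : BFGSState d × USphere d => z.1.G :=
    measurable_fst.comp (measurable_snd.comp hs)
  have hF : Measurable fun z : BFGSState d × USphere d => z.1.F :=
    measurable_snd.comp (measurable_snd.comp hs)
  have hw : Measurable fun z : BFGSState d × USphere d => (z.2 : Vec d) :=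
    measurable_subtype_coe.comp measurable_snd
  have hy := measurable_nextPoint f hx hG
  have hH := (measurable_hess f).comp hy
  have hc := measurable_corr f M hx hG
  have hFc := measurable_mat_smul hc.sqrt.inv hF
  exact measurable_comap_iff.2 (hy.prodMk ((measurable_bfgs (measurable_mat_smul hc hG) hH
    (measurable_app (measurable_transpose hFc) hw)).prodMk (measurable_factorUpdate hFc hH hw)))

end

/-! ### The greedy and the random methods -/

section

open scoped Matrix
open MeasureTheory

variable {d : ℕ} {f : Vec d → ℝ} {M μ L κ : ℝ} {x₀ : Vec d}

theorem quad_smul (c : ℝ) (A : Mat d) (v : Vec d) : quad (c • A) v = c * quad A v :=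
  form_smul A c _ _

theorem trace_smul_one_mul (c : ℝ) (A : Mat d) : ((c • (1 : Mat d)) * A).trace = c * A.trace := by
  rw [Matrix.smul_mul, one_mul, Matrix.trace_smul, smul_eq_mul]

theorem le_one_sub_one_div_mul {d : ℕ} (hd : 1 ≤ d) {a b σ : ℝ} (h : a ≤ σ - b) (hb : σ ≤ d * b) :
    a ≤ (1 - 1 / d) * σ := by
  have hd' : (0 : ℝ) < d := by exact_mod_cast hd
  have : 1 / (d : ℝ) * σ ≤ b := by
    rw [one_div, inv_mul_le_iff₀ hd']
    exact hb
  linarith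

theorem LinearPhase.posSemidef_corrected_sub (hs : Setting M μ L κ f x₀) (hκ : 1 ≤ κ) {k : ℕ}
    {x : Vec d} {G : Mat d} (h : LinearPhase f M κ x₀ k x G) :
    (corr f M x G • G - hess f (nextPoint f x G)).PosSemidef := by
  have hl0 : 0 ≤ M * lam f x₀ := mul_nonneg hs.self_conc.M_pos.le (lam_nonneg f x₀)
  have hη := hκ.trans (le_quality hκ hl0 k)
  exact (h.sandwich.corrected hs.self_conc (by linarith)).posSemidef_sub
    (hs.convex_smooth.posDef _)

theorem LinearPhase.sr1 (hs : Setting M μ L κ f x₀) (hκ : 1 ≤ κ) {k : ℕ}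
    {x : Vec d} {G : Mat d} (h : LinearPhase f M κ x₀ k x G) (u : Vec d) :
    LinearPhase f M κ x₀ (k + 1) (nextPoint f x G)
      (QuasiNewton.sr1 (corr f M x G • G) (hess f (nextPoint f x G)) u) :=
  h.succ hs hκ fun _ _ hsw => hsw.sr1 (hs.convex_smooth.posDef _) u

/-- For SR1 the potential decreases at least by the form of `(G̃ - ∇²f(x₊)) / μ`. -/
theorem LinearPhase.potential_sr1_le (hs : Setting M μ L κ f x₀) (hκ : 1 ≤ κ) {k : ℕ}
    {x : Vec d} {G : Mat d} (h : LinearPhase f M κ x₀ k x G) {u : Vec d} (hu : ‖u‖ = 1) :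
    ((μ⁻¹ • (1 : Mat d)) * (QuasiNewton.sr1 (corr f M x G • G) (hess f (nextPoint f x G)) u
        - hess f (nextPoint f x G))).trace ≤
      ((μ⁻¹ • (1 : Mat d)) * (corr f M x G • G - hess f (nextPoint f x G))).trace
        - quad (μ⁻¹ • (corr f M x G • G - hess f (nextPoint f x G))) u := by
  rw [trace_smul_one_mul, trace_smul_one_mul, quad_smul, ← mul_sub]
  exact mul_le_mul_of_nonneg_left (trace_sr1_sub_le (h.posSemidef_corrected_sub hs hκ) hu)
    (inv_nonneg.2 hs.convex_smooth.mu_pos.le)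

theorem linearPhase_sr1Iter (hs : Setting M μ L κ f x₀) (hκ : 1 ≤ κ) (u : ℕ → Vec d) (k : ℕ) :
    LinearPhase f M κ x₀ k (sr1Iter f M L x₀ u k).x (sr1Iter f M L x₀ u k).G := by
  induction k with
  | zero => exact linearPhase_zero hs
  | succ k ih => exact ih.sr1 hs hκ (u k)

theorem superlinearFrom_greedySR1 (hs : Setting M μ L κ f x₀) (hκ : 1 ≤ κ) (hd : 2 ≤ d)
    {u : ℕ → Vec d} (hu : IsGreedySR1 f M L x₀ u) :
    SuperlinearFrom f (1 - 1 / d) κ (firstStage d κ + secondStage d κ 1)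
      fun k => (sr1Iter f M L x₀ u k).x := by
  have hphase := linearPhase_sr1Iter hs hκ u
  refine superlinearFrom_of_potential_le hs hκ hd (isWeight_smul_one hs)
    (G := fun k => (sr1Iter f M L x₀ u k).G) rfl (fun _ => rfl) hphase fun k => ?_
  refine le_one_sub_one_div_mul (by omega)
    ((hphase k).potential_sr1_le hs hκ (hu k).norm_eq_one) ?_
  rw [trace_smul_one_mul, quad_smul, mul_left_comm]
  exact mul_le_mul_of_nonneg_left (hu k).trace_le (inv_nonneg.2 hs.convex_smooth.mu_pos.le)

theorem measure_superlinearFrom_sr1_ge (hs : Setting M μ L κ f x₀) (hκ : 1 ≤ κ) (hd : 2 ≤ d)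
    {δ : ℝ} (hδ : 0 < δ) {Ω : Type*} [MeasurableSpace Ω] {P : Measure Ω} [IsProbabilityMeasure P]
    {u : ℕ → Ω → USphere d} (hu : IsIIDUnifSphere P u) :
    ENNReal.ofReal (1 - δ) ≤ P {ω | SuperlinearFrom f (1 - 1 / (d + 1)) κ
      (firstStage d κ + secondStage d κ δ)
      fun k => (sr1Iter f M L x₀ (fun j => (u j ω : Vec d)) k).x} := by
  refine measure_superlinearFrom_ge hs hκ hd hδ (isWeight_smul_one hs) hu
    (measurable_sr1Step f M) (pt := SR1State.x) (mat := SR1State.G)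
    (measurable_lyapunov f M κ measurable_const
      (measurable_fst.comp SR1State.measurable_x_G) (measurable_snd.comp SR1State.measurable_x_G))
    (fun _ _ => rfl) (good := fun k s => LinearPhase f M κ x₀ k s.x s.G)
    (fun k s w h => h.sr1 hs hκ w) (fun _ _ h => h) (fun k s h => ?_)
    (s := fun k ω => sr1Iter f M L x₀ (fun j => (u j ω : Vec d)) k) (fun _ => rfl) rfl
    (linearPhase_zero hs) (fun _ _ => rfl)
  refine ⟨μ⁻¹ • (corr f M s.x s.G • s.G - hess f (nextPoint f s.x s.G)), ?_, fun w => ?_⟩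
  · rw [trace_smul_one_mul, Matrix.trace_smul, smul_eq_mul]
  · exact h.potential_sr1_le hs hκ (by simp)

/-- The invariant of the BFGS iteration: besides the linear phase, `Fᵀ F` is the inverse of `G`. -/
structure BFGSPhase (f : Vec d → ℝ) (M κ : ℝ) (x₀ : Vec d) (k : ℕ) (s : BFGSState d) : Prop where
  phase : LinearPhase f M κ x₀ k s.x s.G
  factor : s.Fᵀ * s.F * s.G = 1

theorem bfgsPhase_zero (hs : Setting M μ L κ f x₀) :
    BFGSPhase f M κ x₀ 0 ⟨x₀, L • (1 : Mat d), (Real.sqrt L)⁻¹ • (1 : Mat d)⟩ := by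
  refine ⟨linearPhase_zero hs, ?_⟩
  have hL := hs.convex_smooth.L_pos
  simp only [Matrix.transpose_smul, Matrix.transpose_one, Matrix.smul_mul, Matrix.mul_smul,
    one_mul, smul_smul]
  rw [← mul_assoc, mul_assoc, ← mul_inv, Real.mul_self_sqrt hL.le, mul_inv_cancel₀ hL.ne', one_smul]

theorem BFGSPhase.factor_corrected (hs : Setting M μ L κ f x₀) {k : ℕ} {s : BFGSState d}
    (h : BFGSPhase f M κ x₀ k s) :
    (s.Fcorr f M)ᵀ * s.Fcorr f M * s.Gcorr f M = 1 := by
  have hc : 0 < corr f M s.x s.G :=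
    zero_lt_one.trans_le (one_le_corr hs.self_conc.M_pos.le s.x s.G)
  simp only [BFGSState.Fcorr, BFGSState.Gcorr, Matrix.transpose_smul, Matrix.smul_mul,
    Matrix.mul_smul, smul_smul]
  rw [h.factor, ← mul_assoc, mul_assoc, ← mul_inv, Real.mul_self_sqrt hc.le,
    mul_inv_cancel₀ hc.ne', one_smul]

theorem BFGSPhase.succ (hs : Setting M μ L κ f x₀) (hκ : 1 ≤ κ) {k : ℕ} {s : BFGSState d}
    (h : BFGSPhase f M κ x₀ k s) {w : Vec d} (hw : w ≠ 0) :
    BFGSPhase f M κ x₀ (k + 1) ⟨nextPoint f s.x s.G,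
      bfgs (s.Gcorr f M) (hess f (nextPoint f s.x s.G)) (app (s.Fcorr f M)ᵀ w),
      factorUpdate (s.Fcorr f M) (hess f (nextPoint f s.x s.G)) w⟩ := by
  have hA := hs.convex_smooth.posDef (nextPoint f s.x s.G)
  have hfac := h.factor_corrected hs
  have hl0 : 0 ≤ M * lam f x₀ := mul_nonneg hs.self_conc.M_pos.le (lam_nonneg f x₀)
  have hη := hκ.trans (le_quality hκ hl0 k)
  have hG := (h.phase.sandwich.corrected hs.self_conc (by linarith)).posDef hA
  exact ⟨h.phase.succ hs hκ fun _ hη hsw => hsw.bfgs hA hη (app_transpose_ne_zero hfac hw),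
    factorUpdate_invariant hA hG hfac hw⟩

theorem quad_sub_one (Q : Mat d) {w : Vec d} (hw : ‖w‖ = 1) : quad (Q - 1) w = quad Q w - 1 := by
  rw [quad, Matrix.sub_mulVec, dotProduct_sub, Matrix.one_mulVec, dotProduct_self_eq_norm_sq, hw,
    one_pow, quad]

theorem bfgsPhase_bfgsIter (hs : Setting M μ L κ f x₀) (hκ : 1 ≤ κ) {w : ℕ → Vec d}
    (hw : ∀ k, ‖w k‖ = 1) (k : ℕ) : BFGSPhase f M κ x₀ k (bfgsIter f M L x₀ w k) := by
  induction k with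
  | zero => exact bfgsPhase_zero hs
  | succ k ih => exact ih.succ hs hκ (ne_zero_of_norm_eq_one (hw k))

theorem superlinearFrom_greedyBFGS (hs : Setting M μ L κ f x₀) (hκ : 1 ≤ κ) (hd : 2 ≤ d)
    {w : ℕ → Vec d} (hw : IsGreedyBFGS f M L x₀ w) :
    SuperlinearFrom f (1 - 1 / d) κ (firstStage d κ + secondStage d κ 1)
      fun k => (bfgsIter f M L x₀ w k).x := by
  have hw1 : ∀ k, ‖w k‖ = 1 := fun k => (hw k).norm_eq_one
  have hphase := bfgsPhase_bfgsIter hs hκ hw1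
  refine superlinearFrom_of_potential_le hs hκ hd (isWeight_inv_hess hs hκ)
    (G := fun k => (bfgsIter f M L x₀ w k).G) rfl (fun _ => rfl) (fun k => (hphase k).phase)
    fun k => ?_
  have hA := hs.convex_smooth.posDef (bfgsIter f M L x₀ w (k + 1)).x
  have hfac := (hphase k).factor_corrected hs
  refine le_one_sub_one_div_mul (by omega) (trace_bfgs hA hfac (hw1 k)).le ?_
  have h1 := (hw k).trace_le
  have h2 := trace_inv_conj hA hfac
  rw [Matrix.trace_sub, Matrix.trace_one, Fintype.card_fin] at h2
  rw [mul_sub_one]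
  exact h2.symm.trans_le (sub_le_sub_right h1 _)

theorem measure_superlinearFrom_bfgs_ge (hs : Setting M μ L κ f x₀) (hκ : 1 ≤ κ) (hd : 2 ≤ d)
    {δ : ℝ} (hδ : 0 < δ) {Ω : Type*} [MeasurableSpace Ω] {P : Measure Ω} [IsProbabilityMeasure P]
    {u : ℕ → Ω → USphere d} (hu : IsIIDUnifSphere P u) :
    ENNReal.ofReal (1 - δ) ≤ P {ω | SuperlinearFrom f (1 - 1 / (d + 1)) κ
      (firstStage d κ + secondStage d κ δ)
      fun k => (bfgsIter f M L x₀ (fun j => (u j ω : Vec d)) k).x} := by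
  have hnorm : ∀ w : USphere d, ‖(w : Vec d)‖ = 1 := fun w => by simp
  refine measure_superlinearFrom_ge hs hκ hd hδ (isWeight_inv_hess hs hκ) hu
    (measurable_bfgsStep f M) (pt := BFGSState.x) (mat := BFGSState.G)
    (measurable_lyapunov f M κ (measurable_mat_inv (measurable_hess f))
      (measurable_fst.comp BFGSState.measurable_x_G_F)
      (measurable_fst.comp (measurable_snd.comp BFGSState.measurable_x_G_F)))
    (fun _ _ => rfl) (good := BFGSPhase f M κ x₀)
    (fun k s w h => h.succ hs hκ (ne_zero_of_norm_eq_one (hnorm w))) (fun _ _ h => h.phase)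
    (fun k s h => ?_)
    (s := fun k ω => bfgsIter f M L x₀ (fun j => (u j ω : Vec d)) k) (fun _ => rfl) rfl
    (bfgsPhase_zero hs) (fun _ _ => rfl)
  have hA := hs.convex_smooth.posDef (nextPoint f s.x s.G)
  have hfac := h.factor_corrected hs
  refine ⟨_, trace_inv_conj hA hfac, fun w => ?_⟩
  rw [quad_sub_one _ (hnorm w)]
  exact (trace_bfgs hA hfac (hnorm w)).le

end

end QuasiNewton

end

theorem corollary4 :
    (∃ C : ℝ, 0 < C ∧ ∀ (d : ℕ) (κ : ℝ), 2 ≤ d → 1 ≤ κ →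
      ∃ k₀ : ℕ, (k₀ : ℝ) ≤ C * ((d + κ) * Real.log (d * κ)) ∧
        ∀ (M μ L : ℝ) (f : QuasiNewton.Vec d → ℝ) (x₀ : QuasiNewton.Vec d),
          QuasiNewton.Setting M μ L κ f x₀ →
          (∀ w : ℕ → QuasiNewton.Vec d, QuasiNewton.IsGreedyBFGS f M L x₀ w →
            QuasiNewton.SuperlinearFrom f (1 - 1 / d) κ k₀
              (fun k => (QuasiNewton.bfgsIter f M L x₀ w k).x)) ∧
          (∀ u : ℕ → QuasiNewton.Vec d, QuasiNewton.IsGreedySR1 f M L x₀ u →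
            QuasiNewton.SuperlinearFrom f (1 - 1 / d) κ k₀
              (fun k => (QuasiNewton.sr1Iter f M L x₀ u k).x))) ∧
    (∃ C : ℝ, 0 < C ∧ ∀ (d : ℕ) (κ δ : ℝ), 2 ≤ d → 1 ≤ κ → 0 < δ → δ < 1 →
      ∃ k₀ : ℕ, (k₀ : ℝ) ≤ C * ((d + κ) * Real.log (d * κ / δ)) ∧
        ∀ (M μ L : ℝ) (f : QuasiNewton.Vec d → ℝ) (x₀ : QuasiNewton.Vec d),
          QuasiNewton.Setting M μ L κ f x₀ →
          ∀ {Ω : Type*} [MeasurableSpace Ω] (P : MeasureTheory.Measure Ω)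
            [MeasureTheory.IsProbabilityMeasure P] (u : ℕ → Ω → QuasiNewton.USphere d),
            QuasiNewton.IsIIDUnifSphere P u →
            ENNReal.ofReal (1 - δ) ≤ P {ω | QuasiNewton.SuperlinearFrom f (1 - 1 / (d + 1)) κ k₀
              (fun k => (QuasiNewton.bfgsIter f M L x₀ (fun j => (u j ω : QuasiNewton.Vec d)) k).x)} ∧
            ENNReal.ofReal (1 - δ) ≤ P {ω | QuasiNewton.SuperlinearFrom f (1 - 1 / (d + 1)) κ k₀
              (fun k => (QuasiNewton.sr1Iter f M L x₀ (fun j => (u j ω : QuasiNewton.Vec d)) k).x)}) := by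
  refine ⟨⟨8, by norm_num, fun d κ hd hκ => ⟨_, ?_, fun M μ L f x₀ hs =>
    ⟨fun w hw => QuasiNewton.superlinearFrom_greedyBFGS hs hκ hd hw,
      fun u hu => QuasiNewton.superlinearFrom_greedySR1 hs hκ hd hu⟩⟩⟩,
    ⟨8, by norm_num, fun d κ δ hd hκ hδ hδ1 => ⟨_, QuasiNewton.burnIn_le hd hκ hδ hδ1.le,
      fun M μ L f x₀ hs Ω _ P _ u hu =>
        ⟨QuasiNewton.measure_superlinearFrom_bfgs_ge hs hκ hd hδ hu,
          QuasiNewton.measure_superlinearFrom_sr1_ge hs hκ hd hδ hu⟩⟩⟩⟩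
  simpa using QuasiNewton.burnIn_le hd hκ one_pos le_rfl
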